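/- **Setting.** Let $K\ge 2$, $\sigma>0$, $D>0$ and let $S_1,\dots,S_K\subseteq[K]$ be sets such that every $j\in[K]$ lies in some $S_i$. A learner plays actions $i_1,i_2,\dots\in[K]$. In round $t$, if $i_t=i$, it observes for every $j\in S_i$ a random variable $X_{t,i,j}\sim\mathcal N(\theta_j,\sigma^2)$, where $\theta\in[0,D]^K$ is unknown; the $X_{t,i,j}$, $j\in S_i$, are independent for fixed $(t,i)$, and the observations of different rounds are independent. The choice of $i_t$ depends only on the information available before round $t$ (past observations, and possibly further information, such as payoffs or randomization, independent of the observations in rounds $\ge t$). For $\lambda\in\mathbb R^K$ let $i_1(\lambda)$ be a maximizer of $\lambda_i$, let $i_2(\lambda)$ be a maximizer over $i\ne i_1(\lambda)$, and let $d_i(\lambda)=\lambda_{i_1(\lambda)}-\lambda_i$. Let $$C_\lambda=\Big\{c\in[0,\infty)^K:\ \sum_{i:\,j\in S_i}c_i\ge\frac{2\sigma^2}{d_j(\lambda)^2}\ \ \forall j\ne i_1(\lambda),\quad \sum_{i:\,i_1(\lambda)\in S_i}c_i\ge\frac{2\sigma^2}{d_{i_2(\lambda)}(\lambda)^2}\Big\}$$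 ($C_\lambda=\emptyset$ if $d_{i_2(\lambda)}(\lambda)=0$). Let $c(\lambda)$ denote a minimizer of $\langle c,d(\lambda)\rangle$ over $C_\lambda$ which, among all minimizers, has the smallest coordinate at $i_1(\lambda)$. The regret is $R_T(\theta)=\sum_i \mathbb E[\#\{t\le T: i_t=i\}]\,d_i(\theta)$. **Algorithm 1** (inputs $S$, $\sigma$, $\alpha$, $\beta:\mathbb N\to\mathbb R$). Let $N_i(t)$ and $n_i(t)$ be the numbers of plays and of observations of action $i$ before round $t$, and let $\hat\theta_{t,i}$ be the average of these $n_i(t)$ observations. For $t=1,\dots,K$ play some $i_t$ with $t\in S_{i_t}$. Set $n_e(K+1)=0$. For $t=K+1,K+2,\dots$: * if $N(t)/(4\alpha\log t)\in C_{\hat\theta_t}$, play $i_t=i_1(\hat\theta_t)$ and set $n_e(t+1)=n_e(t)$; * otherwise set $n_e(t+1)=n_e(t)+1$ and: if $\min_i n_i(t)<\beta(n_e(t))/K$, play some $i_t$ such that $S_{i_t}$ contains a minimizer of $n_i(t)$; else play some $i_t$ with $N_{i_t}(t)<c_{i_t}(\hat\theta_t)\,4\alpha\log t$. Choices left open are arbitrary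 (in the last case nothing is prescribed if $c(\hat\theta_t)$ does not exist). **Corollary.** Let $\alpha>2$, and let $\beta:\mathbb N\to\mathbb R$ be non-decreasing with $0\le\beta(n)\le n/2$, $\beta(m+n)\le\beta(m)+\beta(n)$ for all $m,n$, $\beta(n)=o(n)$, and $\sum_{s=0}^\infty\exp\big(-\tfrac{\beta(s)\varepsilon^2}{2K\sigma^2}\big)<\infty$ for every $\varepsilon>0$. Let $\theta\in[0,D]^K$ have a unique optimal action, and suppose that the minimizer of $\langle c,d(\theta)\rangle$ over $C_\theta$ is unique up to its coordinate at $i_1(\theta)$ (which does not enter the objective and can always be increased): any two minimizers agree in all coordinates $i\ne i_1(\theta)$. Then every run of Algorithm 1 in environment $\theta$ satisfies $$\limsup_{T\to\infty}\frac{R_T(\theta)}{\log T}\ \le\ 4\alpha\,\inf_{c\in C_\theta}\langle c,d(\theta)\rangle .$$ -/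

import Mathlib

open MeasureTheory ProbabilityTheory Filter Topology

noncomputable section

namespace SideObs

variable {K : ℕ}

/-! ### Payoff vectors, gaps and the linear program

Actions are the elements of `Fin K`; `S i` is the set of actions whose payoff parameter is observed
(with variance `σ ^ 2`) when action `i` is played. -/

section LinearProgram

variable [NeZero K]

/-- The best action `i₁(θ)`, ties being broken arbitrarily. -/
def best (θ : Fin K → ℝ) : Fin K := (Finite.exists_max θ).choose

theorem le_best (θ : Fin K → ℝ) (i : Fin K) : θ i ≤ θ (best θ) :=
  (Finite.exists_max θ).choose_spec i

/-- The gap `d_i(θ) = θ_{i₁(θ)} - θ_i`. -/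
def gap (θ : Fin K → ℝ) (i : Fin K) : ℝ := θ (best θ) - θ i

/-- The gap `d_{i₂(θ)}(θ)` of a second best action, i.e. the least gap of an action other than
`i₁(θ)`. It is positive exactly when the optimal action is unique (for `2 ≤ K`). -/
def secondGap (θ : Fin K → ℝ) : ℝ := ⨅ j : {j : Fin K // j ≠ best θ}, gap θ j

/-- The polyhedron `C_θ`. When the optimal action is not unique, some of the required amounts
`2 σ² / d²` are infinite and `C_θ` is empty; this is the role of the condition `0 < secondGap θ`. -/
def feasible (S : Fin K → Finset (Fin K)) (σ : ℝ) (θ : Fin K → ℝ) : Set (Fin K → ℝ) :=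
  {c | 0 < secondGap θ ∧ (∀ i, 0 ≤ c i) ∧
    (∀ j, j ≠ best θ → 2 * σ ^ 2 / gap θ j ^ 2 ≤ ∑ i with j ∈ S i, c i) ∧
    2 * σ ^ 2 / secondGap θ ^ 2 ≤ ∑ i with best θ ∈ S i, c i}

/-- The objective `⟨c, d(θ)⟩`. -/
def cost (θ c : Fin K → ℝ) : ℝ := ∑ i, c i * gap θ i

/-- The minimizers of `⟨c, d(θ)⟩` over `C_θ`. -/
def minimizers (S : Fin K → Finset (Fin K)) (σ : ℝ) (θ : Fin K → ℝ) : Set (Fin K → ℝ) :=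
  {c | c ∈ feasible S σ θ ∧ ∀ c' ∈ feasible S σ θ, cost θ c ≤ cost θ c'}

/-- The admissible values of `c(θ)`: minimizers whose coordinate at the best action, which does not
enter the objective, is as small as possible. -/
def lpSolutions (S : Fin K → Finset (Fin K)) (σ : ℝ) (θ : Fin K → ℝ) : Set (Fin K → ℝ) :=
  {c | c ∈ minimizers S σ θ ∧ ∀ c' ∈ minimizers S σ θ, c (best θ) ≤ c' (best θ)}

/-- The solution of the linear program is unique, up to the coordinate of the best action (which can
always be increased without changing the objective). -/
def UniqueLPSolution (S : Fin K → Finset (Fin K)) (σ : ℝ) (θ : Fin K → ℝ) : Prop :=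
  ∀ c ∈ minimizers S σ θ, ∀ c' ∈ minimizers S σ θ, ∀ i, i ≠ best θ → c i = c' i

end LinearProgram

/-! ### The algorithm

`a t` is the action played in round `t = 1, 2, …` and `x t j` is the observation made in round `t` of
the parameter of action `j`; it is only read when `j ∈ S (a t)`. The values at `t = 0` are never
used. -/

/-- `N_i(t)`: the number of plays of action `i` before round `t`. -/
def playCount (a : ℕ → Fin K) (t : ℕ) (i : Fin K) : ℕ :=
  ((Finset.Ico 1 t).filter fun s => a s = i).card

/-- `n_i(t)`: the number of observations of action `i` before round `t`. -/
def obsCount (S : Fin K → Finset (Fin K)) (a : ℕ → Fin K) (t : ℕ) (i : Fin K) : ℕ :=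
  ((Finset.Ico 1 t).filter fun s => i ∈ S (a s)).card

/-- The empirical mean of the observations of action `i` made before round `t`. -/
def estimate (S : Fin K → Finset (Fin K)) (a : ℕ → Fin K) (x : ℕ → Fin K → ℝ) (t : ℕ) :
    Fin K → ℝ :=
  fun i => (∑ s ∈ (Finset.Ico 1 t).filter (fun s => i ∈ S (a s)), x s i) / (obsCount S a t i : ℝ)

section Rules

variable [NeZero K]

/-- The test `N(t) / (4 α log t) ∈ C_{θ̂_t}`. -/
def Exploits (S : Fin K → Finset (Fin K)) (σ α : ℝ) (a : ℕ → Fin K) (x : ℕ → Fin K → ℝ)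
    (t : ℕ) : Prop :=
  (fun i => (playCount a t i : ℝ) / (4 * α * Real.log t)) ∈ feasible S σ (estimate S a x t)

open Classical in
/-- The exploration count `n_e(t)`: it is `0` up to `t = K + 1`, and then increases by one in each
round in which the test fails. -/
def exploreCount (S : Fin K → Finset (Fin K)) (σ α : ℝ) (a : ℕ → Fin K) (x : ℕ → Fin K → ℝ) :
    ℕ → ℕ
  | 0 => 0
  | t + 1 =>
    if K < t ∧ ¬ Exploits S σ α a x t then exploreCount S σ α a x t + 1
    else exploreCount S σ α a x t

/-- Forced exploration is due: `min_i n_i(t) < β(n_e(t)) / K`. -/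
def Underexplored (S : Fin K → Finset (Fin K)) (σ α : ℝ) (β : ℕ → ℝ) (a : ℕ → Fin K)
    (x : ℕ → Fin K → ℝ) (t : ℕ) : Prop :=
  ((⨅ i, obsCount S a t i : ℕ) : ℝ) < β (exploreCount S σ α a x t) / K

/-- The actions `a` obey the rules of the algorithm along the observations `x`. All choices that the
algorithm leaves open are arbitrary. -/
structure FollowsAlgorithm (S : Fin K → Finset (Fin K)) (σ α : ℝ) (β : ℕ → ℝ) (a : ℕ → Fin K)
    (x : ℕ → Fin K → ℝ) : Prop where
  /-- In rounds `1, …, K` each action is observed at least once. -/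
  init : ∀ k : Fin K, k ∈ S (a ((k : ℕ) + 1))
  exploit : ∀ t, K < t → Exploits S σ α a x t → a t = best (estimate S a x t)
  explore : ∀ t, K < t → ¬ Exploits S σ α a x t → Underexplored S σ α β a x t →
    ∃ j, (∀ i, obsCount S a t j ≤ obsCount S a t i) ∧ j ∈ S (a t)
  /-- Otherwise an action with `N_i(t) < c_i(θ̂_t) 4 α log t` is played (nothing is prescribed if
  `c(θ̂_t)` does not exist, which requires a tie among the best estimates). -/
  followLP : ∀ t, K < t → ¬ Exploits S σ α a x t → ¬ Underexplored S σ α β a x t →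
    (lpSolutions S σ (estimate S a x t)).Nonempty →
    ∃ c ∈ lpSolutions S σ (estimate S a x t),
      (playCount a t (a t) : ℝ) < c (a t) * (4 * α * Real.log t)

end Rules

/-! ### The environment -/

variable {Ω : Type*} [mΩ : MeasurableSpace Ω]

/-- Gaussian observations with mean vector `θ`, in the uniform variance model with observation sets
`S`. `X t i j` is the observation of action `j` that playing action `i` in round `t` would produce; it
is only meaningful for `j ∈ S i` (for `j ∉ S i` the variance is infinite, nothing is observed). `ℱ t`
is the information available after round `t`; besides the observations it may contain payoffs and
randomization of the learner. -/
structure GaussianObservations (S : Fin K → Finset (Fin K)) (σ : ℝ) (θ : Fin K → ℝ)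
    (P : Measure Ω) (ℱ : Filtration ℕ mΩ) (X : ℕ → Fin K → Fin K → Ω → ℝ) : Prop where
  adapted : ∀ t i, ∀ j ∈ S i, Measurable[ℱ (t + 1)] (X (t + 1) i j)
  law : ∀ t i, ∀ j ∈ S i, P.map (X (t + 1) i j) = gaussianReal (θ j) (σ ^ 2).toNNReal
  indep_coord : ∀ t i, iIndepFun (fun j : S i => X (t + 1) i j) P
  indep_past : ∀ t, Indep (ℱ t)
    (⨆ p : {p : Fin K × Fin K // p.2 ∈ S p.1},
      MeasurableSpace.comap (X (t + 1) p.1.1 p.1.2) inferInstance) P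

/-- The actions `I 1, I 2, …` are chosen by the algorithm: `I (t + 1)` depends only on the information
available after round `t`, and the rules are obeyed almost surely. -/
structure IsAlgorithmRun [NeZero K] (S : Fin K → Finset (Fin K)) (σ α : ℝ) (β : ℕ → ℝ)
    (P : Measure Ω) (ℱ : Filtration ℕ mΩ) (X : ℕ → Fin K → Fin K → Ω → ℝ)
    (I : ℕ → Ω → Fin K) : Prop where
  nonanticipating : ∀ t, Measurable[ℱ t] (I (t + 1))
  follows : ∀ᵐ ω ∂P, FollowsAlgorithm S σ α β (fun t => I t ω) (fun t j => X t (I t ω) j ω)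

/-- The expected regret `R_T(θ) = ∑ i, E[N_i] d_i(θ)`, where `N_i` is the number of plays of action
`i` in the rounds `1, …, T`. -/
def regret [NeZero K] (θ : Fin K → ℝ) (P : Measure Ω) (I : ℕ → Ω → Fin K) (T : ℕ) : ℝ :=
  ∑ i, (∫ ω, (playCount (fun t => I t ω) (T + 1) i : ℝ) ∂P) * gap θ i

end SideObs

end

/-!
The regret of a run is split, path by path, according to the kind of round (`path_regret_le`).

* A round in which the test succeeds costs nothing unless the empirical best action is wrong. The test
  guarantees both the empirical and the true best action so many observations that one of their
  estimates must then lie outside a confidence interval of logarithmic width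
  (`exists_deviation_of_exploits`). Such a deviation has probability of order `t ^ (1 - α)` in round
  `t`, which is summable because `α > 2`.
* Rounds of forced exploration are counted by the observations they produce: up to a constant there
  are at most `β n` of them, `n` being the exploration count (`card_underexplored_le`). As
  `β n ≤ n / 2`, the exploration count is in turn at most about twice the number of the remaining
  exploration rounds, which is of order `log T`; and `β` is sublinear.
* In the other exploration rounds every action has been observed at least `β n / K` times. The
  exploration count takes each value in at most one of these rounds, so by a maximal inequality the
  expected number of those with an inaccurate estimate is at most a constant times
  `∑ exp (-β s ε² / (2 K σ²))`.
* If all estimates are accurate, the linear program for the estimates has solutions that exceed the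
  one for `θ` only slightly (`eventually_lpSolutions`). This is a compactness argument: limits of
  solutions are minimizers for `θ`, and those are unique away from the best action. An action whose
  number of plays is below `C_i 4 α log t` whenever it is chosen is chosen at most `⌈C_i 4 α log T⌉`
  times, and this gives the leading term.

The deviation bounds hold although the number of observations of an action is random and depends on
past observations. They come from Doob's maximal inequality for the exponential martingale
`exp (l Z - l² σ² n / 2)`, where `Z` is the sum of the `n` centred observations of an action so far
(`expMart_martingale`, `prob_deviation_le`).
-/

noncomputable section

namespace SideObs

/-! ### Gaps and the polyhedron of the linear program -/

theorem nonempty_ne {K : ℕ} (hK : 2 ≤ K) (b : Fin K) : Nonempty {j : Fin K // j ≠ b} := by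
  have : Nontrivial (Fin K) := Fin.nontrivial_iff_two_le.2 hK
  obtain ⟨j, hj⟩ := exists_ne b
  exact ⟨⟨j, hj⟩⟩

section LinearProgramming

variable {K : ℕ} [NeZero K] {S : Fin K → Finset (Fin K)} {σ : ℝ} {θ c : Fin K → ℝ}

theorem gap_nonneg (θ : Fin K → ℝ) (i : Fin K) : 0 ≤ gap θ i :=
  sub_nonneg.2 (le_best θ i)

theorem gap_best (θ : Fin K → ℝ) : gap θ (best θ) = 0 := sub_self _

theorem secondGap_le_gap {j : Fin K} (hj : j ≠ best θ) : secondGap θ ≤ gap θ j :=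
  ciInf_le (f := fun j : {j : Fin K // j ≠ best θ} => gap θ j)
    (Set.finite_range _).bddBelow ⟨j, hj⟩

theorem best_eq_of_forall_lt {b : Fin K} (h : ∀ i, i ≠ b → θ i < θ b) : best θ = b := by
  by_contra hne
  exact absurd (le_best θ b) (not_le.2 (h _ hne))

theorem secondGap_pos (hK : 2 ≤ K) (h : ∀ i, i ≠ best θ → θ i < θ (best θ)) :
    0 < secondGap θ := by
  have := nonempty_ne hK (best θ)
  obtain ⟨j, hj⟩ := exists_eq_ciInf_of_finite (f := fun j : {j : Fin K // j ≠ best θ} => gap θ j)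
  rw [secondGap, ← hj]
  exact sub_pos.2 (h _ j.2)

/-- The right-hand side of the constraint of `feasible` that belongs to action `j`. It is meaningful
only when `secondGap θ` is positive, since division by zero gives zero. -/
def demand (σ : ℝ) (θ : Fin K → ℝ) (j : Fin K) : ℝ :=
  2 * σ ^ 2 / (if j = best θ then secondGap θ else gap θ j) ^ 2

theorem demand_nonneg (σ : ℝ) (θ : Fin K → ℝ) (j : Fin K) : 0 ≤ demand σ θ j := by
  unfold demand; positivity

theorem mem_feasible_iff : c ∈ feasible S σ θ ↔
    0 < secondGap θ ∧ (∀ i, 0 ≤ c i) ∧ ∀ j, demand σ θ j ≤ ∑ i with j ∈ S i, c i := by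
  constructor
  · rintro ⟨h1, h2, h3, h4⟩
    refine ⟨h1, h2, fun j => ?_⟩
    by_cases hj : j = best θ
    · subst hj; simpa [demand] using h4
    · simpa [demand, hj] using h3 j hj
  · rintro ⟨h1, h2, h3⟩
    refine ⟨h1, h2, fun j hj => ?_, ?_⟩
    · simpa [demand, hj] using h3 j
    · simpa [demand] using h3 (best θ)

theorem const_mem_feasible (hS : ∀ j, ∃ i, j ∈ S i) (hθ : 0 < secondGap θ) {R : ℝ}
    (hR : ∀ j, demand σ θ j ≤ R) : (fun _ => R) ∈ feasible S σ θ := by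
  have hR0 : 0 ≤ R := (demand_nonneg σ θ (best θ)).trans (hR _)
  refine mem_feasible_iff.2 ⟨hθ, fun _ => hR0, fun j => ?_⟩
  obtain ⟨i, hi⟩ := hS j
  exact (hR j).trans (Finset.single_le_sum (f := fun _ : Fin K => R) (fun _ _ => hR0)
    (Finset.mem_filter.2 ⟨Finset.mem_univ i, hi⟩))

/-- Amounts above the largest demand can be cut off without losing feasibility. -/
theorem min_mem_feasible {R : ℝ} (hR : ∀ j, demand σ θ j ≤ R) (hc : c ∈ feasible S σ θ) :
    (fun i => min (c i) R) ∈ feasible S σ θ := by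
  obtain ⟨hθ, hc0, hcd⟩ := mem_feasible_iff.1 hc
  have hR0 : 0 ≤ R := (demand_nonneg σ θ (best θ)).trans (hR _)
  have h0 : ∀ i, 0 ≤ min (c i) R := fun i => le_min (hc0 i) hR0
  refine mem_feasible_iff.2 ⟨hθ, h0, fun j => ?_⟩
  by_cases h : ∃ i, j ∈ S i ∧ R < c i
  · obtain ⟨i, hi, hiR⟩ := h
    calc demand σ θ j ≤ R := hR j
      _ = min (c i) R := (min_eq_right hiR.le).symm
      _ ≤ _ := Finset.single_le_sum (f := fun i => min (c i) R) (fun i _ => h0 i)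
        (Finset.mem_filter.2 ⟨Finset.mem_univ i, hi⟩)
  · push Not at h
    refine (hcd j).trans (Finset.sum_le_sum fun i hi => ?_)
    exact le_min le_rfl (h i (Finset.mem_filter.1 hi).2)

theorem cost_mono {c c' : Fin K → ℝ} (h : ∀ i, c i ≤ c' i) : cost θ c ≤ cost θ c' :=
  Finset.sum_le_sum fun i _ => mul_le_mul_of_nonneg_right (h i) (gap_nonneg θ i)

theorem isClosed_feasible : IsClosed (feasible S σ θ) := by
  have : feasible S σ θ = {_c | 0 < secondGap θ} ∩ ((⋂ i, {c : Fin K → ℝ | 0 ≤ c i}) ∩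
      ⋂ j, {c | demand σ θ j ≤ ∑ i with j ∈ S i, c i}) := by
    ext c; simp [mem_feasible_iff]
  rw [this]
  refine isClosed_const.inter ((isClosed_iInter fun i => ?_).inter (isClosed_iInter fun j => ?_))
  · exact isClosed_le continuous_const (continuous_apply i)
  · exact isClosed_le continuous_const (by fun_prop)

theorem continuous_cost : Continuous (cost θ) := by unfold cost; fun_prop

/-- By truncation it suffices to minimize over a compact box, first the objective and then the
coordinate at the best action. -/
theorem lpSolutions_nonempty (hS : ∀ j, ∃ i, j ∈ S i) (hθ : 0 < secondGap θ) :
    (lpSolutions S σ θ).Nonempty := by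
  obtain ⟨R, hR⟩ : ∃ R, ∀ j, demand σ θ j ≤ R := by
    obtain ⟨j, hj⟩ := Finite.exists_max (demand σ θ); exact ⟨_, hj⟩
  have hR0 : 0 ≤ R := (demand_nonneg σ θ (best θ)).trans (hR _)
  set box : Set (Fin K → ℝ) := Set.Icc 0 fun _ => R
  have hbox : ∀ c ∈ feasible S σ θ, (fun i => min (c i) R) ∈ box := fun c hc =>
    ⟨fun i => le_min (hc.2.1 i) hR0, fun i => min_le_right _ _⟩
  have hcpt : IsCompact (feasible S σ θ ∩ box) := isCompact_Icc.inter_left isClosed_feasible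
  obtain ⟨c₀, ⟨hc₀, hc₀b⟩, hmin⟩ := hcpt.exists_isMinOn
    ⟨_, const_mem_feasible hS hθ hR, fun _ => hR0, le_rfl⟩ continuous_cost.continuousOn
  have hc₀m : c₀ ∈ minimizers S σ θ := ⟨hc₀, fun c hc =>
    (hmin ⟨min_mem_feasible hR hc, hbox c hc⟩).trans (cost_mono fun i => min_le_left _ _)⟩
  have heq : minimizers S σ θ = feasible S σ θ ∩ {c | cost θ c ≤ cost θ c₀} := by
    ext c
    exact ⟨fun h => ⟨h.1, h.2 _ hc₀⟩, fun h => ⟨h.1, fun c' hc' => h.2.trans (hc₀m.2 c' hc')⟩⟩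
  have hcpt' : IsCompact (minimizers S σ θ ∩ box) := by
    refine isCompact_Icc.inter_left ?_
    rw [heq]
    exact isClosed_feasible.inter (isClosed_le continuous_cost continuous_const)
  -- among the minimizers in the box, take one with the smallest coordinate at the best action
  obtain ⟨c₁, ⟨hc₁, hc₁b⟩, hmin₁⟩ := hcpt'.exists_isMinOn ⟨c₀, hc₀m, hc₀b⟩
    (continuous_apply (best θ)).continuousOn
  refine ⟨c₁, hc₁, fun c hc => ?_⟩
  have hcm : (fun i => min (c i) R) ∈ minimizers S σ θ := by
    rw [heq] at hc ⊢
    exact ⟨min_mem_feasible hR hc.1, (cost_mono fun i => min_le_left _ _).trans hc.2⟩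
  exact (hmin₁ ⟨hcm, hbox c hc.1⟩).trans (min_le_left _ _)

/-- Solutions never use more than the largest demand: cutting them off would strictly lower the
objective, or the coordinate at the best action. -/
theorem lpSolutions_le {R : ℝ} (hR : ∀ j, demand σ θ j ≤ R) (hc : c ∈ lpSolutions S σ θ)
    (i : Fin K) : c i ≤ R := by
  have hf := min_mem_feasible hR hc.1.1
  have hcost : cost θ (fun i => min (c i) R) ≤ cost θ c := cost_mono fun i => min_le_left _ _
  by_contra! hi
  by_cases hb : i = best θ
  · subst hb
    have := hc.2 _ ⟨hf, fun c' hc' => hcost.trans (hc.1.2 c' hc')⟩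
    exact absurd (this.trans (min_le_right _ _)) (not_le.2 hi)
  · refine absurd (hc.1.2 _ hf) (not_le.2 ?_)
    refine Finset.sum_lt_sum (fun k _ => mul_le_mul_of_nonneg_right (min_le_left _ _)
      (gap_nonneg θ k)) ⟨i, Finset.mem_univ i, ?_⟩
    exact mul_lt_mul_of_pos_right (min_lt_iff.2 (Or.inr hi))
      (hc.1.1.1.trans_le (secondGap_le_gap hb))

/-! ### Stability of the linear program -/

theorem eventually_best_eq (h : ∀ i, i ≠ best θ → θ i < θ (best θ)) :
    ∀ᶠ θ' in 𝓝 θ, best θ' = best θ := by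
  have : ∀ᶠ θ' : Fin K → ℝ in 𝓝 θ, ∀ i, i ≠ best θ → θ' i < θ' (best θ) := by
    refine eventually_all.2 fun i => ?_
    by_cases hi : i = best θ
    · simp [hi]
    · have := (continuous_apply i).continuousAt.eventually_lt
        ((continuous_apply (best θ)).continuousAt (x := θ)) (h i hi)
      filter_upwards [this] with θ' h _ using h
  filter_upwards [this] with θ' h using best_eq_of_forall_lt h

theorem continuousAt_gap (h : ∀ i, i ≠ best θ → θ i < θ (best θ)) (i : Fin K) :
    ContinuousAt (fun θ' => gap θ' i) θ := by
  have : ContinuousAt (fun θ' : Fin K → ℝ => θ' (best θ) - θ' i) θ := by fun_prop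
  refine this.congr ?_
  filter_upwards [eventually_best_eq h] with θ' h'
  rw [gap, h']

theorem continuousAt_secondGap (hK : 2 ≤ K) (h : ∀ i, i ≠ best θ → θ i < θ (best θ)) :
    ContinuousAt (secondGap (K := K)) θ := by
  have := nonempty_ne hK (best θ)
  have : ContinuousAt (fun θ' : Fin K → ℝ => (Finset.univ : Finset {j // j ≠ best θ}).inf'
      Finset.univ_nonempty fun j => gap θ' j) θ :=
    ContinuousAt.finset_inf'_apply _ fun i _ => continuousAt_gap h i
  refine this.congr ?_
  filter_upwards [eventually_best_eq h] with θ' h'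
  rw [Finset.inf'_univ_eq_ciInf, secondGap, h']

theorem continuousAt_demand (hK : 2 ≤ K) (h : ∀ i, i ≠ best θ → θ i < θ (best θ)) (j : Fin K) :
    ContinuousAt (fun θ' => demand σ θ' j) θ := by
  have hpos := secondGap_pos hK h
  by_cases hj : j = best θ
  · have : ContinuousAt (fun θ' => 2 * σ ^ 2 / secondGap θ' ^ 2) θ :=
      continuousAt_const.div ((continuousAt_secondGap hK h).pow 2) (pow_ne_zero 2 hpos.ne')
    refine this.congr ?_
    filter_upwards [eventually_best_eq h] with θ' h'
    rw [demand, h', if_pos hj]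
  · have : ContinuousAt (fun θ' => 2 * σ ^ 2 / gap θ' j ^ 2) θ :=
      continuousAt_const.div ((continuousAt_gap h j).pow 2)
        (pow_ne_zero 2 (hpos.trans_le (secondGap_le_gap hj)).ne')
    refine this.congr ?_
    filter_upwards [eventually_best_eq h] with θ' h'
    rw [demand, h', if_neg hj]

/-- A limit of solutions for parameters tending to `θ` is a minimizer for `θ`: feasibility passes to
the limit, and any competitor for `θ` becomes feasible for nearby parameters once all its
coordinates are increased by a small amount. -/
theorem mem_minimizers_of_tendsto (hK : 2 ≤ K) (hS : ∀ j, ∃ i, j ∈ S i)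
    (h : ∀ i, i ≠ best θ → θ i < θ (best θ)) {u v : ℕ → Fin K → ℝ}
    (hu : Tendsto u atTop (𝓝 θ)) (hv : Tendsto v atTop (𝓝 c))
    (huv : ∀ n, v n ∈ minimizers S σ (u n)) : c ∈ minimizers S σ θ := by
  have hvi : ∀ i, Tendsto (fun n => v n i) atTop (𝓝 (c i)) := fun i =>
    ((continuous_apply i).tendsto c).comp hv
  have hgap : ∀ i, Tendsto (fun n => gap (u n) i) atTop (𝓝 (gap θ i)) := fun i =>
    (continuousAt_gap h i).tendsto.comp hu
  have hdem : ∀ j, Tendsto (fun n => demand σ (u n) j) atTop (𝓝 (demand σ θ j)) := fun j =>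
    (continuousAt_demand hK h j).tendsto.comp hu
  have hf := fun n => mem_feasible_iff.1 (huv n).1
  refine ⟨mem_feasible_iff.2 ⟨secondGap_pos hK h,
    fun i => ge_of_tendsto' (hvi i) fun n => (hf n).2.1 i, fun j => ?_⟩, fun c' hc' => ?_⟩
  · exact le_of_tendsto_of_tendsto' (hdem j) (tendsto_finsetSum _ fun i _ => hvi i)
      fun n => (hf n).2.2 j
  · obtain ⟨-, hc0, hcd⟩ := mem_feasible_iff.1 hc'
    have key : ∀ η : ℝ, 0 < η → cost θ c ≤ cost θ (fun i => c' i + η) := by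
      intro η hη
      have hev : ∀ᶠ n in atTop, ∀ j, demand σ (u n) j ≤ demand σ θ j + η :=
        eventually_all.2 fun j => (hdem j).eventually_le_const (by linarith)
      have hleft : Tendsto (fun n => cost (u n) (v n)) atTop (𝓝 (cost θ c)) :=
        tendsto_finsetSum _ fun i _ => (hvi i).mul (hgap i)
      have hright : Tendsto (fun n => cost (u n) fun i => c' i + η) atTop
          (𝓝 (cost θ fun i => c' i + η)) :=
        tendsto_finsetSum _ fun i _ => tendsto_const_nhds.mul (hgap i)
      refine le_of_tendsto_of_tendsto hleft hright ?_
      filter_upwards [hev] with n hn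
      refine (huv n).2 _ (mem_feasible_iff.2 ⟨(hf n).1, fun i => by linarith [hc0 i], fun j => ?_⟩)
      rw [Finset.sum_add_distrib]
      obtain ⟨i, hi⟩ := hS j
      have := Finset.single_le_sum (f := fun _ : Fin K => η) (fun _ _ => hη.le)
        (Finset.mem_filter.2 ⟨Finset.mem_univ i, hi⟩ : i ∈ Finset.univ.filter fun i => j ∈ S i)
      linarith [hn j, hcd j]
    have hlim : Tendsto (fun η : ℝ => cost θ (fun i => c' i + η)) (𝓝[>] 0)
        (𝓝 (cost θ c')) := by
      have : Continuous fun η : ℝ => cost θ (fun i => c' i + η) :=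
        continuous_cost.comp (by fun_prop)
      simpa using (this.tendsto 0).mono_left nhdsWithin_le_nhds
    exact ge_of_tendsto hlim (eventually_mem_nhdsWithin.mono key)

/-- Near `θ`, the best action is unchanged and the solutions of the linear program exist, are
uniformly bounded, and away from the best action exceed the solution `c` for `θ` only slightly. -/
theorem eventually_lpSolutions (hK : 2 ≤ K) (hS : ∀ j, ∃ i, j ∈ S i)
    (h : ∀ i, i ≠ best θ → θ i < θ (best θ)) (huniq : UniqueLPSolution S σ θ)
    (hc : c ∈ minimizers S σ θ) {δ : ℝ} (hδ : 0 < δ) :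
    ∃ R : ℝ, 0 < R ∧ ∀ᶠ θ' in 𝓝 θ, best θ' = best θ ∧ (lpSolutions S σ θ').Nonempty ∧
      ∀ c' ∈ lpSolutions S σ θ', (∀ i, c' i ≤ R) ∧ ∀ i, i ≠ best θ → c' i ≤ c i + δ := by
  obtain ⟨j₀, hj₀⟩ := Finite.exists_max (demand σ θ)
  set R := demand σ θ j₀ + 1
  have hR : 0 < R := add_pos_of_nonneg_of_pos (demand_nonneg _ _ _) one_pos
  have hdem : ∀ᶠ θ' in 𝓝 θ, ∀ j, demand σ θ' j ≤ R := eventually_all.2 fun j =>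
    (continuousAt_demand hK h j).tendsto.eventually_le_const ((hj₀ j).trans_lt (lt_add_one _))
  have hpos : ∀ᶠ θ' : Fin K → ℝ in 𝓝 θ, 0 < secondGap θ' :=
    (continuousAt_secondGap hK h).eventually_const_lt (secondGap_pos hK h)
  have hclose : ∀ᶠ θ' in 𝓝 θ, ∀ c' ∈ lpSolutions S σ θ', ∀ i, i ≠ best θ → c' i ≤ c i + δ := by
    by_contra hfreq
    obtain ⟨u, hu, hux⟩ :=
      exists_seq_forall_of_frequently ((not_eventually.1 hfreq).and_eventually hdem)
    have hex : ∀ n, ∃ c' ∈ lpSolutions S σ (u n), ∃ i, i ≠ best θ ∧ c i + δ < c' i := by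
      intro n; have := (hux n).1; push Not at this; exact this
    choose v hv i hi hvi using hex
    have hbox : ∀ n, v n ∈ Set.Icc (0 : Fin K → ℝ) fun _ => R := fun n =>
      ⟨(hv n).1.1.2.1, lpSolutions_le (hux n).2 (hv n)⟩
    obtain ⟨c', -, φ, hφ, hlim⟩ := isCompact_Icc.tendsto_subseq hbox
    have hmem : c' ∈ minimizers S σ θ := mem_minimizers_of_tendsto hK hS h
      (hu.comp hφ.tendsto_atTop) hlim fun n => (hv _).1
    have hsmall : ∀ᶠ n in atTop, ∀ k, k ≠ best θ → v (φ n) k < c k + δ := by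
      refine eventually_all.2 fun k => ?_
      by_cases hk : k = best θ
      · simp [hk]
      · have hlimk : Tendsto (fun n => v (φ n) k) atTop (𝓝 (c' k)) :=
          ((continuous_apply k).tendsto c').comp hlim
        have : c' k < c k + δ := by rw [huniq c' hmem c hc k hk]; linarith
        filter_upwards [hlimk.eventually_lt_const this] with n hn _ using hn
    obtain ⟨n, hn⟩ := hsmall.exists
    exact absurd (hn _ (hi _)) (not_lt.2 (hvi _).le)
  refine ⟨R, hR, ?_⟩
  filter_upwards [hdem, hpos, hclose, eventually_best_eq h] with θ' h1 h2 h3 h4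
  exact ⟨h4, lpSolutions_nonempty hS h2, fun c' hc' => ⟨lpSolutions_le h1 hc', h3 c' hc'⟩⟩

end LinearProgramming

/-! ### Deviations of the empirical means -/

section Counts

variable {K : ℕ} {S : Fin K → Finset (Fin K)} {θ : Fin K → ℝ} {a : ℕ → Fin K} {x : ℕ → Fin K → ℝ}

/-- The sum of the centred observations of action `j` made before round `t`. -/
def devSum (S : Fin K → Finset (Fin K)) (θ : Fin K → ℝ) (a : ℕ → Fin K) (x : ℕ → Fin K → ℝ)
    (t : ℕ) (j : Fin K) : ℝ :=
  ∑ s ∈ (Finset.Ico 1 t).filter (fun s => j ∈ S (a s)), (x s j - θ j)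

theorem card_filter_Ico_succ (p : ℕ → Prop) [DecidablePred p] {t : ℕ} (ht : 1 ≤ t) :
    ((Finset.Ico 1 (t + 1)).filter p).card =
      ((Finset.Ico 1 t).filter p).card + if p t then 1 else 0 := by
  rw [Finset.card_filter, Finset.card_filter, Finset.sum_Ico_succ_top ht]

theorem obsCount_succ {t : ℕ} (ht : 1 ≤ t) (j : Fin K) :
    obsCount S a (t + 1) j = obsCount S a t j + if j ∈ S (a t) then 1 else 0 :=
  card_filter_Ico_succ _ ht

theorem devSum_succ {t : ℕ} (ht : 1 ≤ t) (j : Fin K) :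
    devSum S θ a x (t + 1) j =
      devSum S θ a x t j + if j ∈ S (a t) then x t j - θ j else 0 := by
  rw [devSum, devSum, Finset.sum_filter, Finset.sum_filter, Finset.sum_Ico_succ_top ht]

theorem estimate_sub {t : ℕ} {j : Fin K} (h : 0 < obsCount S a t j) :
    estimate S a x t j - θ j = devSum S θ a x t j / obsCount S a t j := by
  have h' : (obsCount S a t j : ℝ) ≠ 0 := by exact_mod_cast h.ne'
  rw [estimate, devSum, Finset.sum_sub_distrib, Finset.sum_const, nsmul_eq_mul, sub_div]
  congr 1
  exact (mul_div_cancel_left₀ _ h').symm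

theorem obsCount_le (t : ℕ) (j : Fin K) : obsCount S a (t + 1) j ≤ t := by
  simpa [obsCount] using Finset.card_filter_le (Finset.Ico 1 (t + 1)) fun s => j ∈ S (a s)

end Counts

section Deviations

variable {K : ℕ} {S : Fin K → Finset (Fin K)} {σ : ℝ} {θ : Fin K → ℝ}
  {Ω : Type*} {mΩ : MeasurableSpace Ω} {P : Measure Ω} {ℱ : Filtration ℕ mΩ}
  {X : ℕ → Fin K → Fin K → Ω → ℝ} {I : ℕ → Ω → Fin K}

/-- The random number of observations of action `j` in the first `t` rounds. -/
def runObs (S : Fin K → Finset (Fin K)) (I : ℕ → Ω → Fin K) (j : Fin K) (t : ℕ) (ω : Ω) : ℕ :=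
  obsCount S (fun s => I s ω) (t + 1) j

/-- The random sum of the centred observations of action `j` made in the first `t` rounds. -/
def runDev (S : Fin K → Finset (Fin K)) (θ : Fin K → ℝ) (X : ℕ → Fin K → Fin K → Ω → ℝ)
    (I : ℕ → Ω → Fin K) (j : Fin K) (t : ℕ) (ω : Ω) : ℝ :=
  devSum S θ (fun s => I s ω) (fun s j => X s (I s ω) j ω) (t + 1) j

theorem runObs_succ (j : Fin K) (t : ℕ) (ω : Ω) :
    runObs S I j (t + 1) ω = runObs S I j t ω + if j ∈ S (I (t + 1) ω) then 1 else 0 :=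
  obsCount_succ (Nat.le_add_left 1 t) j

theorem runDev_succ (j : Fin K) (t : ℕ) (ω : Ω) :
    runDev S θ X I j (t + 1) ω = runDev S θ X I j t ω +
      if j ∈ S (I (t + 1) ω) then X (t + 1) (I (t + 1) ω) j ω - θ j else 0 :=
  devSum_succ (Nat.le_add_left 1 t) j

theorem runObs_measurable (hI : ∀ t, Measurable[ℱ t] (I (t + 1))) (j : Fin K) (t : ℕ) :
    Measurable (runObs S I j t) := by
  induction t with
  | zero => exact measurable_const
  | succ t ih =>
    have h1 : Measurable (I (t + 1)) := (hI t).mono (ℱ.le t) le_rfl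
    have h2 : Measurable fun ω => if j ∈ S (I (t + 1) ω) then 1 else 0 :=
      (measurable_of_finite fun i : Fin K => if j ∈ S i then 1 else 0).comp h1
    have : runObs S I j (t + 1) =
        fun ω => runObs S I j t ω + if j ∈ S (I (t + 1) ω) then 1 else 0 :=
      funext (runObs_succ j t)
    rw [this]
    exact ih.add h2

theorem runDev_measurable (hX : GaussianObservations S σ θ P ℱ X)
    (hI : ∀ t, Measurable[ℱ t] (I (t + 1))) (j : Fin K) (t : ℕ) :
    Measurable (runDev S θ X I j t) := by
  induction t with
  | zero =>
    have : runDev S θ X I j 0 = fun _ => 0 := by ext ω; simp [runDev, devSum]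
    rw [this]; exact measurable_const
  | succ t ih =>
    have h1 : Measurable (I (t + 1)) := (hI t).mono (ℱ.le t) le_rfl
    have : runDev S θ X I j (t + 1) = fun ω => runDev S θ X I j t ω +
        ∑ i with j ∈ S i, {ω | I (t + 1) ω = i}.indicator (fun ω => X (t + 1) i j ω - θ j) ω := by
      ext ω
      rw [runDev_succ]
      simp [Set.indicator_apply, Finset.sum_ite_eq]
    rw [this]
    refine ih.add (Finset.measurable_sum _ fun i hi => ?_)
    refine Measurable.indicator ?_ (h1 (measurableSet_singleton i))
    exact ((hX.adapted t i j (Finset.mem_filter.1 hi).2).mono (ℱ.le _) le_rfl).sub_const _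

/-- The factor by which playing action `i` in round `t + 1` multiplies the exponential martingale of
action `j`. -/
def expFactor (S : Fin K → Finset (Fin K)) (σ : ℝ) (θ : Fin K → ℝ)
    (X : ℕ → Fin K → Fin K → Ω → ℝ) (l : ℝ) (j : Fin K) (t : ℕ) (i : Fin K) (ω : Ω) : ℝ :=
  if j ∈ S i then Real.exp (l * (X (t + 1) i j ω - θ j) - l ^ 2 * σ ^ 2 / 2) else 1

/-- The exponential martingale `exp (l Z - l² σ² n / 2)`, where `Z` is the sum of the `n` centred
observations of action `j` in the first `t` rounds. -/
def expMart (S : Fin K → Finset (Fin K)) (σ : ℝ) (θ : Fin K → ℝ) (X : ℕ → Fin K → Fin K → Ω → ℝ)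
    (I : ℕ → Ω → Fin K) (l : ℝ) (j : Fin K) (t : ℕ) (ω : Ω) : ℝ :=
  Real.exp (l * runDev S θ X I j t ω - l ^ 2 * σ ^ 2 / 2 * runObs S I j t ω)

theorem expMart_zero (l : ℝ) (j : Fin K) : expMart S σ θ X I l j 0 = fun _ => 1 := by
  ext ω; simp [expMart, runDev, runObs, devSum, obsCount]

theorem expMart_succ (l : ℝ) (j : Fin K) (t : ℕ) (ω : Ω) :
    expMart S σ θ X I l j (t + 1) ω =
      expMart S σ θ X I l j t ω * expFactor S σ θ X l j t (I (t + 1) ω) ω := by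
  rw [expMart, expMart, expFactor, runDev_succ, runObs_succ]
  split_ifs
  · rw [← Real.exp_add]; congr 1; push_cast; ring
  · simp

/-- Splitting according to the action played in round `t + 1` makes every summand a product of a
quantity known before that round with an independent factor. -/
theorem indicator_expMart_succ (l : ℝ) (j : Fin K) (t : ℕ) (A : Set Ω) :
    A.indicator (expMart S σ θ X I l j (t + 1)) = fun ω => ∑ i,
      (A ∩ {ω | I (t + 1) ω = i}).indicator (expMart S σ θ X I l j t) ω *
        expFactor S σ θ X l j t i ω := by
  ext ω
  rw [Finset.sum_eq_single (I (t + 1) ω)]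
  · by_cases h : ω ∈ A <;> simp [h, expMart_succ]
  · intro i _ hi
    rw [Set.indicator_of_notMem, zero_mul]
    exact fun h => hi h.2.symm
  · simp

theorem expFactor_measurable (hX : GaussianObservations S σ θ P ℱ X) (l : ℝ) (j : Fin K) (t : ℕ)
    (i : Fin K) : Measurable[ℱ (t + 1)] (expFactor S σ θ X l j t i) := by
  by_cases h : j ∈ S i
  · have : expFactor S σ θ X l j t i =
        (fun y => Real.exp (l * (y - θ j) - l ^ 2 * σ ^ 2 / 2)) ∘ X (t + 1) i j := by
      ext ω; simp [expFactor, h]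
    rw [this]
    exact Measurable.comp (by fun_prop) (hX.adapted t i j h)
  · have : expFactor S σ θ X l j t i = fun _ => 1 := by ext ω; simp [expFactor, h]
    rw [this]; exact measurable_const

theorem expFactor_comap_le (l : ℝ) (j : Fin K) (t : ℕ) (i : Fin K) :
    MeasurableSpace.comap (expFactor S σ θ X l j t i) inferInstance ≤
      ⨆ p : {p : Fin K × Fin K // p.2 ∈ S p.1},
        MeasurableSpace.comap (X (t + 1) p.1.1 p.1.2) inferInstance := by
  by_cases h : j ∈ S i
  · have : expFactor S σ θ X l j t i =
        (fun y => Real.exp (l * (y - θ j) - l ^ 2 * σ ^ 2 / 2)) ∘ X (t + 1) i j := by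
      ext ω; simp [expFactor, h]
    rw [this, ← MeasurableSpace.comap_comp]
    refine (MeasurableSpace.comap_mono (Measurable.comap_le ?_)).trans
      (le_iSup (fun p : {p : Fin K × Fin K // p.2 ∈ S p.1} =>
        MeasurableSpace.comap (X (t + 1) p.1.1 p.1.2) inferInstance) ⟨(i, j), h⟩)
    fun_prop
  · have : expFactor S σ θ X l j t i = fun _ => 1 := by ext ω; simp [expFactor, h]
    rw [this]; simp [MeasurableSpace.comap_const]

theorem expMart_measurable (hX : GaussianObservations S σ θ P ℱ X)
    (hI : ∀ t, Measurable[ℱ t] (I (t + 1))) (l : ℝ) (j : Fin K) (t : ℕ) :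
    Measurable[ℱ t] (expMart S σ θ X I l j t) := by
  induction t with
  | zero => rw [expMart_zero]; exact measurable_const
  | succ t ih =>
    have hle : ℱ t ≤ ℱ (t + 1) := ℱ.mono t.le_succ
    have := indicator_expMart_succ (S := S) (σ := σ) (θ := θ) (X := X) (I := I) l j t Set.univ
    rw [Set.indicator_univ] at this
    rw [this]
    refine Finset.measurable_sum _ fun i _ => Measurable.mul ?_ (expFactor_measurable hX l j t i)
    exact (ih.mono hle le_rfl).indicator
      (MeasurableSet.univ.inter (hle _ (hI t (measurableSet_singleton i))))

variable [IsProbabilityMeasure P]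

theorem expFactor_integrable_and_integral (hX : GaussianObservations S σ θ P ℱ X) (l : ℝ)
    (j : Fin K) (t : ℕ) (i : Fin K) :
    Integrable (expFactor S σ θ X l j t i) P ∧ ∫ ω, expFactor S σ θ X l j t i ω ∂P = 1 := by
  by_cases h : j ∈ S i
  · have hlaw := hX.law t i j h
    have hm : AEMeasurable (X (t + 1) i j) P :=
      ((hX.adapted t i j h).mono (ℱ.le _) le_rfl).aemeasurable
    have heq : expFactor S σ θ X l j t i = fun ω =>
        Real.exp (-(θ j * l + σ ^ 2 * l ^ 2 / 2)) * Real.exp (l * X (t + 1) i j ω) := by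
      ext ω
      rw [expFactor, if_pos h, ← Real.exp_add]; congr 1; ring
    have hint : Integrable (fun ω => Real.exp (l * X (t + 1) i j ω)) P := by
      have := integrable_exp_mul_gaussianReal (μ := θ j) (v := (σ ^ 2).toNNReal) l
      rw [← hlaw] at this
      exact this.comp_aemeasurable hm
    have hmgf := mgf_gaussianReal hlaw l
    rw [Real.coe_toNNReal _ (sq_nonneg σ), mgf] at hmgf
    rw [heq]
    refine ⟨hint.const_mul _, ?_⟩
    rw [integral_const_mul, hmgf, ← Real.exp_add]
    simp
  · have : expFactor S σ θ X l j t i = fun _ => 1 := by ext ω; simp [expFactor, h]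
    rw [this]; simp

/-- The information before round `t + 1` is independent of the observations of that round, so that
conditionally the increment factor has mean one. -/
theorem integral_mul_expFactor (hX : GaussianObservations S σ θ P ℱ X) (l : ℝ) (j : Fin K) (t : ℕ)
    (i : Fin K) {G : Ω → ℝ} (hG : Measurable[ℱ t] G) (hGi : Integrable G P) :
    Integrable (fun ω => G ω * expFactor S σ θ X l j t i ω) P ∧
      ∫ ω, G ω * expFactor S σ θ X l j t i ω ∂P = ∫ ω, G ω ∂P := by
  obtain ⟨hW, hW1⟩ := expFactor_integrable_and_integral hX l j t i
  have hind : IndepFun G (expFactor S σ θ X l j t i) P :=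
    (IndepFun_iff_Indep _ _ _).2 (indep_of_indep_of_le_left (indep_of_indep_of_le_right
      (hX.indep_past t) (expFactor_comap_le l j t i)) hG.comap_le)
  refine ⟨hind.integrable_mul hGi hW, ?_⟩
  rw [hind.integral_fun_mul_eq_mul_integral hGi.1 hW.1, hW1, mul_one]

theorem expMart_integrable (hX : GaussianObservations S σ θ P ℱ X)
    (hI : ∀ t, Measurable[ℱ t] (I (t + 1))) (l : ℝ) (j : Fin K) (t : ℕ) :
    Integrable (expMart S σ θ X I l j t) P := by
  induction t with
  | zero => rw [expMart_zero]; exact integrable_const 1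
  | succ t ih =>
    have := indicator_expMart_succ (S := S) (σ := σ) (θ := θ) (X := X) (I := I) l j t Set.univ
    rw [Set.indicator_univ] at this
    rw [this]
    have hA : ∀ i, MeasurableSet[ℱ t] (Set.univ ∩ {ω | I (t + 1) ω = i}) := fun i =>
      MeasurableSet.univ.inter (hI t (measurableSet_singleton i))
    exact integrable_finsetSum _ fun i _ => (integral_mul_expFactor hX l j t i
      ((expMart_measurable hX hI l j t).indicator (hA i))
      (ih.indicator (ℱ.le t _ (hA i)))).1

theorem expMart_martingale (hX : GaussianObservations S σ θ P ℱ X)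
    (hI : ∀ t, Measurable[ℱ t] (I (t + 1))) (l : ℝ) (j : Fin K) :
    Martingale (expMart S σ θ X I l j) ℱ P := by
  refine martingale_of_setIntegral_eq_succ
    (fun t => (expMart_measurable hX hI l j t).stronglyMeasurable)
    (expMart_integrable hX hI l j) fun t A hA => ?_
  have hAi : ∀ i, MeasurableSet[ℱ t] (A ∩ {ω | I (t + 1) ω = i}) := fun i =>
    hA.inter (hI t (measurableSet_singleton i))
  have key := fun i => integral_mul_expFactor hX l j t i
    ((expMart_measurable hX hI l j t).indicator (hAi i))
    ((expMart_integrable hX hI l j t).indicator (ℱ.le t _ (hAi i)))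
  rw [← integral_indicator (ℱ.le t _ hA), ← integral_indicator (ℱ.le t _ hA),
    indicator_expMart_succ, integral_finsetSum _ fun i _ => (key i).1]
  simp_rw [(key _).2]
  rw [← integral_finsetSum _ fun i _ =>
    (expMart_integrable hX hI l j t).indicator (ℱ.le t _ (hAi i))]
  congr 1
  ext ω
  rw [Finset.sum_eq_single (I (t + 1) ω)]
  · by_cases h : ω ∈ A <;> simp [h]
  · intro i _ hi
    exact Set.indicator_of_notMem (fun h => hi h.2.symm) _
  · simp

/-- Doob's maximal inequality for the exponential martingale, whose mean is one. -/
theorem expMart_maximal (hX : GaussianObservations S σ θ P ℱ X)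
    (hI : ∀ t, Measurable[ℱ t] (I (t + 1))) (l : ℝ) (j : Fin K) (y : ℝ) (T : ℕ) :
    P.real {ω | ∃ t ≤ T, Real.exp y ≤ expMart S σ θ X I l j t ω} ≤ Real.exp (-y) := by
  have hM := expMart_martingale hX hI l j
  obtain ⟨u, hu⟩ : ∃ u : NNReal, (u : ℝ) = Real.exp y := ⟨⟨_, (Real.exp_pos y).le⟩, rfl⟩
  have hmax := maximal_ineq hM.submartingale (fun t ω => (Real.exp_pos _).le) (ε := u) T
  set E := {ω | ∃ t ≤ T, Real.exp y ≤ expMart S σ θ X I l j t ω}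
  have hE : {ω | (u : ℝ) ≤
      (Finset.range (T + 1)).sup' Finset.nonempty_range_add_one
        fun k => expMart S σ θ X I l j k ω} = E := by
    ext ω; simp [E, hu, Finset.le_sup'_iff]
  rw [hE] at hmax
  have h1 : ∫ ω in E, expMart S σ θ X I l j T ω ∂P ≤ 1 := by
    refine (setIntegral_le_integral (expMart_integrable hX hI l j T)
      (ae_of_all _ fun ω => (Real.exp_pos _).le)).trans ?_
    have := hM.setIntegral_eq (Nat.zero_le T) (MeasurableSet.univ)
    rw [setIntegral_univ, setIntegral_univ, expMart_zero] at this
    rw [← this]; simp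
  have h2 := ENNReal.toReal_mono ENNReal.ofReal_ne_top hmax
  have hnn : 0 ≤ ∫ ω in E, expMart S σ θ X I l j T ω ∂P :=
    integral_nonneg fun ω => (Real.exp_pos _).le
  rw [ENNReal.toReal_mul, ENNReal.toReal_ofReal hnn] at h2
  have h3 : Real.exp y * P.real E ≤ 1 := by
    rw [← hu]
    exact h2.trans h1
  rw [Real.exp_neg, ← one_div, le_div_iff₀ (Real.exp_pos y), mul_comm]
  exact h3

/-- Uniformly over the first `T` rounds, a deviation of size `ε` of an empirical mean based on at
least `m` observations is exponentially unlikely. -/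
theorem prob_deviation_le (hσ : 0 < σ) (hX : GaussianObservations S σ θ P ℱ X)
    (hI : ∀ t, Measurable[ℱ t] (I (t + 1))) (j : Fin K) {m ε : ℝ} (hε : 0 < ε) (T : ℕ) :
    P.real {ω | ∃ t ≤ T, m ≤ runObs S I j t ω ∧
      ε * runObs S I j t ω ≤ |runDev S θ X I j t ω|} ≤ 2 * Real.exp (-(m * ε ^ 2 / (2 * σ ^ 2))) := by
  set y := m * ε ^ 2 / (2 * σ ^ 2)
  set E : ℝ → Set Ω := fun l => {ω | ∃ t ≤ T, Real.exp y ≤ expMart S σ θ X I l j t ω}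
  have hsub : {ω | ∃ t ≤ T, m ≤ runObs S I j t ω ∧
      ε * runObs S I j t ω ≤ |runDev S θ X I j t ω|} ⊆ E (ε / σ ^ 2) ∪ E (-(ε / σ ^ 2)) := by
    rintro ω ⟨t, ht, hm, hdev⟩
    -- on either side the exponent is at least `n ε² / (2 σ²)` for this choice of `l = ± ε / σ²`
    have hexp : ∀ z : ℝ, ε * runObs S I j t ω ≤ z →
        y ≤ ε / σ ^ 2 * z - (ε / σ ^ 2) ^ 2 * σ ^ 2 / 2 * runObs S I j t ω := by
      intro z hz
      have h1 : y ≤ runObs S I j t ω * ε ^ 2 / (2 * σ ^ 2) := by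
        exact div_le_div_of_nonneg_right (mul_le_mul_of_nonneg_right hm (sq_nonneg ε))
          (by positivity)
      have h2 : ε / σ ^ 2 * (ε * runObs S I j t ω) ≤ ε / σ ^ 2 * z := by gcongr
      have h3 : ε / σ ^ 2 * (ε * runObs S I j t ω) -
          (ε / σ ^ 2) ^ 2 * σ ^ 2 / 2 * runObs S I j t ω =
          runObs S I j t ω * ε ^ 2 / (2 * σ ^ 2) := by
        field_simp; ring
      linarith
    rcases le_abs.1 hdev with h | h
    · exact Or.inl ⟨t, ht, Real.exp_le_exp.2 (hexp _ h)⟩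
    · refine Or.inr ⟨t, ht, Real.exp_le_exp.2 ((hexp _ h).trans_eq ?_)⟩
      ring
  calc _ ≤ P.real (E (ε / σ ^ 2) ∪ E (-(ε / σ ^ 2))) := measureReal_mono hsub
    _ ≤ P.real (E (ε / σ ^ 2)) + P.real (E (-(ε / σ ^ 2))) := measureReal_union_le _ _
    _ ≤ _ := by
      rw [two_mul]
      exact add_le_add (expMart_maximal hX hI _ j y T) (expMart_maximal hX hI _ j y T)

/-- A deviation bound normalized by the random number of observations: a union bound over the
possible values of that number. -/
theorem prob_normalized_deviation_le (hσ : 0 < σ) (hX : GaussianObservations S σ θ P ℱ X)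
    (hI : ∀ t, Measurable[ℱ t] (I (t + 1))) (j : Fin K) {y : ℝ} (hy : 0 < y) (t : ℕ) :
    P.real {ω | 0 < runObs S I j t ω ∧
      2 * σ ^ 2 * y * runObs S I j t ω ≤ runDev S θ X I j t ω ^ 2} ≤ t * (2 * Real.exp (-y)) := by
  -- for `n` observations, `ε n` is the accuracy with exponent `n (ε n)² / (2 σ²) = y`
  set ε : ℕ → ℝ := fun n => √(2 * σ ^ 2 * y / n)
  set E : ℕ → Set Ω := fun n => {ω | ∃ s ≤ t, (n : ℝ) ≤ runObs S I j s ω ∧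
      ε n * runObs S I j s ω ≤ |runDev S θ X I j s ω|}
  have hsub : {ω | 0 < runObs S I j t ω ∧
      2 * σ ^ 2 * y * runObs S I j t ω ≤ runDev S θ X I j t ω ^ 2} ⊆
      ⋃ n ∈ Finset.Icc 1 t, E n := by
    rintro ω ⟨hpos, hdev⟩
    have hpos' : (0 : ℝ) < runObs S I j t ω := by exact_mod_cast hpos
    refine Set.mem_biUnion (x := runObs S I j t ω)
      (Finset.mem_coe.2 (Finset.mem_Icc.2 ⟨hpos, obsCount_le t j⟩)) ⟨t, le_rfl, le_rfl, ?_⟩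
    refine le_of_sq_le_sq ?_ (abs_nonneg _)
    rw [sq_abs, mul_pow, Real.sq_sqrt (by positivity)]
    refine le_trans (le_of_eq ?_) hdev
    field_simp
  calc _ ≤ P.real (⋃ n ∈ Finset.Icc 1 t, E n) := 
      measureReal_mono hsub (measure_ne_top _ _)
    _ ≤ ∑ n ∈ Finset.Icc 1 t, P.real (E n) := measureReal_biUnion_finset_le _ _
    _ ≤ ∑ n ∈ Finset.Icc 1 t, 2 * Real.exp (-y) := by
      refine Finset.sum_le_sum fun n hn => ?_
      have hn : (0 : ℝ) < n := by exact_mod_cast (Finset.mem_Icc.1 hn).1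
      refine (prob_deviation_le hσ hX hI j (m := n)
        (Real.sqrt_pos.2 (by positivity : 0 < 2 * σ ^ 2 * y / n)) t).trans_eq ?_
      rw [Real.sq_sqrt (by positivity)]
      congr 3
      field_simp
    _ = t * (2 * Real.exp (-y)) := by simp

end Deviations

/-! ### Counting rounds along a path -/

/-- If a monotone counter increases in every round of `A` and is below `y` there, then `A` has at most
`⌈y⌉₊` elements, since the counter takes distinct values on `A`. -/
theorem card_le_of_counter {f : ℕ → ℕ} (hf : Monotone f) {A : Finset ℕ} {y : ℝ}
    (hstep : ∀ t ∈ A, f t < f (t + 1)) (hlt : ∀ t ∈ A, (f t : ℝ) < y) : A.card ≤ ⌈y⌉₊ := by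
  rw [← Finset.card_range ⌈y⌉₊]
  refine Finset.card_le_card_of_injOn f
    (fun t ht => Finset.mem_coe.2 (Finset.mem_range.2 (Nat.lt_ceil.2 (hlt t ht)))) ?_
  intro s hs t ht hst
  rcases lt_trichotomy s t with h | h | h
  · exact absurd hst ((hstep s hs).trans_le (hf h)).ne
  · exact h
  · exact absurd hst ((hstep t ht).trans_le (hf h)).ne'

section Path

variable {K : ℕ} {S : Fin K → Finset (Fin K)} {σ α : ℝ} {β : ℕ → ℝ} {θ : Fin K → ℝ}
  {a : ℕ → Fin K} {x : ℕ → Fin K → ℝ}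

theorem playCount_succ {t : ℕ} (ht : 1 ≤ t) (i : Fin K) :
    playCount a (t + 1) i = playCount a t i + if a t = i then 1 else 0 :=
  card_filter_Ico_succ _ ht

theorem playCount_mono (i : Fin K) : Monotone fun t => playCount a t i := fun _ _ h =>
  Finset.card_le_card (Finset.filter_subset_filter _ (Finset.Ico_subset_Ico_right h))

theorem obsCount_mono (i : Fin K) : Monotone fun t => obsCount S a t i := fun _ _ h =>
  Finset.card_le_card (Finset.filter_subset_filter _ (Finset.Ico_subset_Ico_right h))

theorem sum_playCount (t : ℕ) (j : Fin K) :
    ∑ i with j ∈ S i, playCount a t i = obsCount S a t j := by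
  rw [obsCount, Finset.card_eq_sum_card_fiberwise (f := a) (t := Finset.univ.filter (j ∈ S ·))]
  · refine Finset.sum_congr rfl fun i hi => ?_
    rw [playCount, Finset.filter_filter]
    congr 1
    refine Finset.filter_congr fun s _ => ⟨fun h => ⟨?_, h⟩, fun h => h.2⟩
    rw [h]; exact (Finset.mem_filter.1 hi).2
  · intro s hs
    have := (Finset.mem_filter.1 (Finset.mem_coe.1 hs)).2
    simpa using this

theorem devSum_eq_mul {t : ℕ} {j : Fin K} (h : 0 < obsCount S a t j) :
    devSum S θ a x t j = obsCount S a t j * (estimate S a x t j - θ j) := by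
  have h' : (obsCount S a t j : ℝ) ≠ 0 := by exact_mod_cast h.ne'
  rw [estimate_sub h, mul_div_cancel₀ _ h']

variable [NeZero K]

theorem sum_playCount_mul_gap (T : ℕ) :
    ∑ i, (playCount a (T + 1) i : ℝ) * gap θ i = ∑ t ∈ Finset.range T, gap θ (a (t + 1)) := by
  induction T with
  | zero => simp [playCount]
  | succ T ih =>
    rw [Finset.sum_range_succ, ← ih]
    simp_rw [playCount_succ (Nat.le_add_left 1 T)]
    push_cast
    simp [add_mul, Finset.sum_add_distrib]

theorem exploreCount_le_succ (t : ℕ) :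
    exploreCount S σ α a x t ≤ exploreCount S σ α a x (t + 1) := by
  rw [exploreCount]; split_ifs <;> omega

theorem exploreCount_mono : Monotone (exploreCount S σ α a x) :=
  monotone_nat_of_le_succ exploreCount_le_succ

theorem exploreCount_lt_succ {t : ℕ} (ht : K < t) (he : ¬ Exploits S σ α a x t) :
    exploreCount S σ α a x t < exploreCount S σ α a x (t + 1) := by
  rw [exploreCount, if_pos ⟨ht, he⟩]; exact Nat.lt_succ_self _

open Classical in
/-- The rounds `t + 1 ≤ T` in which the test fails. -/
def exploreRounds (S : Fin K → Finset (Fin K)) (σ α : ℝ) (a : ℕ → Fin K) (x : ℕ → Fin K → ℝ)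
    (T : ℕ) : Finset ℕ :=
  (Finset.range T).filter fun t => K < t + 1 ∧ ¬ Exploits S σ α a x (t + 1)

theorem mem_exploreRounds {T t : ℕ} : t ∈ exploreRounds S σ α a x T ↔
    t < T ∧ K < t + 1 ∧ ¬ Exploits S σ α a x (t + 1) := by
  classical
  rw [exploreRounds, Finset.mem_filter, Finset.mem_range]

theorem exploreCount_eq_card (T : ℕ) :
    exploreCount S σ α a x (T + 1) = (exploreRounds S σ α a x T).card := by
  classical
  induction T with
  | zero => simp [exploreCount, exploreRounds]
  | succ T ih =>
    rw [exploreCount, ih, exploreRounds, exploreRounds, Finset.range_add_one,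
      Finset.filter_insert]
    split_ifs with h
    · rw [Finset.card_insert_of_notMem (by simp)]
    · rfl

theorem exploreCount_lt_of_mem {T t : ℕ} (ht : t ∈ exploreRounds S σ α a x T) :
    exploreCount S σ α a x (t + 1) < T := by
  obtain ⟨h1, h2, h3⟩ := mem_exploreRounds.1 ht
  refine (exploreCount_lt_succ h2 h3).trans_le
    ((exploreCount_mono (Nat.succ_le_succ h1)).trans ?_)
  rw [exploreCount_eq_card]
  classical
  exact (Finset.card_filter_le _ _).trans_eq (Finset.card_range T)

theorem obsCount_pos (h : FollowsAlgorithm S σ α β a x) {t : ℕ} (ht : K < t) (j : Fin K) :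
    0 < obsCount S a t j :=
  Finset.card_pos.2 ⟨j + 1, Finset.mem_filter.2
    ⟨Finset.mem_Ico.2 ⟨Nat.le_add_left 1 _, by have := j.2; omega⟩, h.init j⟩⟩

/-- If the test succeeds with a wrong empirical best action, then one of the two actions involved has
an estimate which is far off relative to its number of observations. -/
theorem exists_deviation_of_exploits (hα : 0 < α) (h : FollowsAlgorithm S σ α β a x)
    {t : ℕ} (ht : K < t) (ht1 : 1 < t) (he : Exploits S σ α a x t) (hne : a t ≠ best θ) :
    ∃ j, 0 < obsCount S a t j ∧
      2 * σ ^ 2 * (α * Real.log t) * obsCount S a t j ≤ devSum S θ a x t j ^ 2 := by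
  rw [h.exploit t ht he] at hne
  set θ' := estimate S a x t with hθ'
  have hlog : 0 < Real.log t := Real.log_pos (by exact_mod_cast ht1)
  have hL : 0 < 4 * α * Real.log t := by positivity
  obtain ⟨hpos, -, hd, hdb⟩ := he
  have hsum : ∀ j, ∑ i with j ∈ S i, (playCount a t i : ℝ) / (4 * α * Real.log t) =
      obsCount S a t j / (4 * α * Real.log t) := fun j => by
    rw [← Finset.sum_div, ← sum_playCount]; push_cast; rfl
  rw [hsum] at hdb
  have hd1 := hd _ hne.symm
  rw [hsum] at hd1
  set g := gap θ' (best θ)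
  have hsg : secondGap θ' ≤ g := secondGap_le_gap hne.symm
  have hg : 0 < g := hpos.trans_le hsg
  have hdb' : 2 * σ ^ 2 / g ^ 2 ≤ obsCount S a t (best θ') / (4 * α * Real.log t) := by
    refine le_trans ?_ hdb
    gcongr
  have hfin : ∀ j, 2 * σ ^ 2 / g ^ 2 ≤ obsCount S a t j / (4 * α * Real.log t) →
      g / 2 ≤ |θ' j - θ j| → 0 < obsCount S a t j ∧
      2 * σ ^ 2 * (α * Real.log t) * obsCount S a t j ≤ devSum S θ a x t j ^ 2 := by
    intro j hj hdev
    have hn := obsCount_pos h ht j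
    refine ⟨hn, ?_⟩
    rw [div_le_div_iff₀ (by positivity) hL] at hj
    rw [devSum_eq_mul hn, ← hθ', mul_pow, ← sq_abs (θ' j - θ j)]
    have h2 : (g / 2) ^ 2 ≤ |θ' j - θ j| ^ 2 := by gcongr
    have hn' : (0 : ℝ) ≤ obsCount S a t j := Nat.cast_nonneg _
    calc 2 * σ ^ 2 * (α * Real.log t) * obsCount S a t j
        = obsCount S a t j * (2 * σ ^ 2 * (4 * α * Real.log t)) / 4 := by ring
      _ ≤ obsCount S a t j * (obsCount S a t j * g ^ 2) / 4 := by gcongr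
      _ = (obsCount S a t j : ℝ) ^ 2 * (g / 2) ^ 2 := by ring
      _ ≤ _ := by gcongr
  have hθb : θ (best θ') ≤ θ (best θ) := le_best θ _
  have hgdef : g = θ' (best θ') - θ' (best θ) := rfl
  -- the estimated gap `g` has the wrong sign, so one of its two estimates is off by at least `g / 2`
  by_cases hcase : g / 2 ≤ θ' (best θ') - θ (best θ')
  · exact ⟨_, hfin _ hdb' (hcase.trans (le_abs_self _))⟩
  · refine ⟨_, hfin (best θ) hd1 (le_trans ?_ (neg_le_abs _))⟩
    linarith

/-- Each round of forced exploration observes a least observed action, which has fewer than `β n / K`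
observations, `n` being the final exploration count; this happens at most `⌈β n / K⌉` times per
action. -/
theorem card_underexplored_le (hβ : Monotone β) (hβ0 : ∀ n, 0 ≤ β n)
    (h : FollowsAlgorithm S σ α β a x) (T : ℕ) {U : Finset ℕ}
    (hU : ∀ t ∈ U, t ∈ exploreRounds S σ α a x T ∧ Underexplored S σ α β a x (t + 1)) :
    (U.card : ℝ) ≤ β (exploreCount S σ α a x (T + 1)) + K := by
  classical
  set y := β (exploreCount S σ α a x (T + 1)) / K
  have hK : (0 : ℝ) < K := by exact_mod_cast Nat.pos_of_ne_zero (NeZero.ne K)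
  have hy : 0 ≤ y := div_nonneg (hβ0 _) hK.le
  set Uj : Fin K → Finset ℕ := fun j =>
    U.filter fun t => j ∈ S (a (t + 1)) ∧ (obsCount S a (t + 1) j : ℝ) < y
  have hsub : U ⊆ Finset.univ.biUnion Uj := by
    intro t ht
    obtain ⟨hte, htu⟩ := hU t ht
    obtain ⟨h1, h2, h3⟩ := mem_exploreRounds.1 hte
    obtain ⟨j, hj, hjS⟩ := h.explore (t + 1) h2 h3 htu
    refine Finset.mem_biUnion.2 ⟨j, Finset.mem_univ j, Finset.mem_filter.2 ⟨ht, hjS, ?_⟩⟩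
    have hmin : obsCount S a (t + 1) j ≤ ⨅ i, obsCount S a (t + 1) i := le_ciInf hj
    calc (obsCount S a (t + 1) j : ℝ) ≤ ((⨅ i, obsCount S a (t + 1) i : ℕ) : ℝ) := by
          exact_mod_cast hmin
      _ < β (exploreCount S σ α a x (t + 1)) / K := htu
      _ ≤ y := div_le_div_of_nonneg_right
          (hβ (exploreCount_mono (by omega))) hK.le
  have hUj : ∀ j, (Uj j).card ≤ ⌈y⌉₊ := fun j => by
    refine card_le_of_counter (f := fun t => obsCount S a (t + 1) j)
      (fun s t hst => obsCount_mono j (Nat.succ_le_succ hst)) (fun t ht => ?_) fun t ht => ?_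
    · have := (Finset.mem_filter.1 ht).2.1
      change obsCount S a (t + 1) j < obsCount S a (t + 1 + 1) j
      rw [obsCount_succ (Nat.le_add_left 1 t), if_pos this]
      exact Nat.lt_succ_self _
    · exact (Finset.mem_filter.1 ht).2.2
  have hcard : U.card ≤ K * ⌈y⌉₊ := by
    refine (Finset.card_le_card hsub).trans (Finset.card_biUnion_le.trans ?_)
    refine (Finset.sum_le_sum fun j _ => hUj j).trans ?_
    simp
  calc (U.card : ℝ) ≤ K * (⌈y⌉₊ : ℝ) := by exact_mod_cast hcard
    _ ≤ K * (y + 1) := by gcongr; exact (Nat.ceil_lt_add_one hy).le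
    _ = _ := by rw [mul_add, mul_div_cancel₀ _ hK.ne', mul_one]

/-- The number of rounds prescribed by the linear program for action `i`, along estimates for which
its `i`-th coordinate is at most `C i`. -/
theorem card_followLP_le (hα : 0 < α) (h : FollowsAlgorithm S σ α β a x) {C : Fin K → ℝ}
    (hC : ∀ i, 0 ≤ C i) (T : ℕ) (i : Fin K) {A : Finset ℕ}
    (hA : ∀ t ∈ A, t ∈ exploreRounds S σ α a x T ∧ ¬ Underexplored S σ α β a x (t + 1) ∧
      (lpSolutions S σ (estimate S a x (t + 1))).Nonempty ∧
      ∀ c ∈ lpSolutions S σ (estimate S a x (t + 1)), ∀ i, c i ≤ C i)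
    (hAi : ∀ t ∈ A, a (t + 1) = i) : A.card ≤ ⌈C i * (4 * α * Real.log T)⌉₊ := by
  refine card_le_of_counter (f := fun t => playCount a (t + 1) i)
    (fun s t hst => playCount_mono i (Nat.succ_le_succ hst)) (fun t ht => ?_) fun t ht => ?_
  · rw [playCount_succ (Nat.le_add_left 1 t), if_pos (hAi t ht)]
    exact Nat.lt_succ_self _
  · obtain ⟨hte, htu, hne, hc⟩ := hA t ht
    obtain ⟨h1, h2, h3⟩ := mem_exploreRounds.1 hte
    obtain ⟨c, hcm, hcl⟩ := h.followLP (t + 1) h2 h3 htu hne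
    rw [hAi t ht] at hcl
    have hlog0 : 0 ≤ Real.log ((t + 1 : ℕ) : ℝ) := Real.log_natCast_nonneg _
    have hlog : Real.log ((t + 1 : ℕ) : ℝ) ≤ Real.log T :=
      Real.log_le_log (by positivity) (by exact_mod_cast h1)
    refine hcl.trans_le ?_
    have := hc c hcm i
    have := hC i
    gcongr

open Classical in
/-- The rounds `t + 1 ≤ T` before which some estimate deviates by more than its logarithmic
confidence width. -/
def wrongRounds (S : Fin K → Finset (Fin K)) (σ α : ℝ) (θ : Fin K → ℝ) (a : ℕ → Fin K)
    (x : ℕ → Fin K → ℝ) (T : ℕ) : Finset ℕ :=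
  (Finset.range T).filter fun t => ∃ j, 0 < obsCount S a (t + 1) j ∧
    2 * σ ^ 2 * (α * Real.log (t + 1 : ℕ)) * obsCount S a (t + 1) j ≤
      devSum S θ a x (t + 1) j ^ 2

open Classical in
/-- The values `s < T` of the exploration count for which at some time some estimate that is based on
at least `β s / K` observations is off by at least `ε`. -/
def badPhases (S : Fin K → Finset (Fin K)) (β : ℕ → ℝ) (θ : Fin K → ℝ) (ε : ℝ) (a : ℕ → Fin K)
    (x : ℕ → Fin K → ℝ) (T : ℕ) : Finset ℕ :=
  (Finset.range T).filter fun s => ∃ j, ∃ t ≤ T, β s / K ≤ obsCount S a (t + 1) j ∧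
    ε * obsCount S a (t + 1) j ≤ |devSum S θ a x (t + 1) j|

/-- The exploration count maps the exploration rounds that are not forced and have a bad estimate
injectively to bad phases. -/
theorem card_badRounds_le (h : FollowsAlgorithm S σ α β a x) {ε : ℝ} (T : ℕ)
    {A : Finset ℕ} (hA : ∀ t ∈ A, t ∈ exploreRounds S σ α a x T ∧
      ¬ Underexplored S σ α β a x (t + 1) ∧ ∃ j, ε ≤ |estimate S a x (t + 1) j - θ j|) :
    A.card ≤ (badPhases S β θ ε a x T).card := by
  refine Finset.card_le_card_of_injOn (fun t => exploreCount S σ α a x (t + 1)) ?_ ?_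
  · intro t ht
    obtain ⟨hte, htu, j, hj⟩ := hA t ht
    obtain ⟨h1, h2, h3⟩ := mem_exploreRounds.1 hte
    refine Finset.mem_coe.2 (Finset.mem_filter.2 ⟨Finset.mem_range.2 (exploreCount_lt_of_mem hte),
      j, t, h1.le, ?_, ?_⟩)
    · have hmin : (⨅ i, obsCount S a (t + 1) i) ≤ obsCount S a (t + 1) j :=
        ciInf_le (OrderBot.bddBelow _) j
      refine (not_lt.1 htu).trans ?_
      exact_mod_cast hmin
    · have hn := obsCount_pos h h2 j
      rw [devSum_eq_mul hn, abs_mul, Nat.abs_cast, mul_comm]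
      gcongr
  · intro s hs t ht hst
    obtain ⟨-, hs2, hs3⟩ := mem_exploreRounds.1 (hA s hs).1
    obtain ⟨-, ht2, ht3⟩ := mem_exploreRounds.1 (hA t ht).1
    rcases lt_trichotomy s t with hlt | hlt | hlt
    · exact absurd hst ((exploreCount_lt_succ hs2 hs3).trans_le
        (exploreCount_mono (Nat.succ_le_succ hlt))).ne
    · exact hlt
    · exact absurd hst ((exploreCount_lt_succ ht2 ht3).trans_le
        (exploreCount_mono (Nat.succ_le_succ hlt))).ne'

/-- The regret along a path: a main term governed by the linear program, a sublogarithmic forced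
exploration term, and the numbers of rounds and of exploration phases with bad estimates. -/
theorem path_regret_le (hα : 0 < α) (hβ : Monotone β)
    (hβ_bound : ∀ n, 0 ≤ β n ∧ β n ≤ n / 2) (hβ_subadd : ∀ m n, β (m + n) ≤ β m + β n)
    (h : FollowsAlgorithm S σ α β a x) {C : Fin K → ℝ} (hC : ∀ i, 0 ≤ C i) {ε : ℝ}
    (hε : ∀ θ' : Fin K → ℝ, (∀ j, |θ' j - θ j| < ε) → (lpSolutions S σ θ').Nonempty ∧
      ∀ c ∈ lpSolutions S σ θ', ∀ i, c i ≤ C i)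
    {M : ℝ} (hM : ∀ i, gap θ i ≤ M) (T : ℕ) :
    ∑ i, (playCount a (T + 1) i : ℝ) * gap θ i ≤
      ∑ i, (⌈C i * (4 * α * Real.log T)⌉₊ : ℝ) * gap θ i +
      M * (2 * K + β (2 * K + 2 * ∑ i, ⌈C i * (4 * α * Real.log T)⌉₊) +
        (wrongRounds S σ α θ a x T).card + 2 * (badPhases S β θ ε a x T).card) := by
  classical
  set G := ∑ i, ⌈C i * (4 * α * Real.log T)⌉₊ with hG
  set W := wrongRounds S σ α θ a x T
  set E := exploreRounds S σ α a x T with hE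
  set U := E.filter fun t => Underexplored S σ α β a x (t + 1)
  set N := E.filter fun t => ¬ Underexplored S σ α β a x (t + 1)
  set B := N.filter fun t => ∃ j, ε ≤ |estimate S a x (t + 1) j - θ j|
  set A := N.filter fun t => ¬ ∃ j, ε ≤ |estimate S a x (t + 1) j - θ j|
  have hM0 : 0 ≤ M := (gap_nonneg θ (best θ)).trans (hM _)
  have hAspec : ∀ t ∈ A, t ∈ E ∧ ¬ Underexplored S σ α β a x (t + 1) ∧
      (lpSolutions S σ (estimate S a x (t + 1))).Nonempty ∧
      ∀ c ∈ lpSolutions S σ (estimate S a x (t + 1)), ∀ i, c i ≤ C i := by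
    intro t ht
    obtain ⟨h1, h2⟩ := Finset.mem_filter.1 ht
    obtain ⟨h3, h4⟩ := Finset.mem_filter.1 h1
    push Not at h2
    exact ⟨h3, h4, hε _ h2⟩
  have hAi : ∀ i, (A.filter fun t => a (t + 1) = i).card ≤ ⌈C i * (4 * α * Real.log T)⌉₊ :=
    fun i => card_followLP_le hα h hC T i (fun t ht => hAspec t (Finset.mem_filter.1 ht).1)
      fun t ht => (Finset.mem_filter.1 ht).2
  have hAcard : A.card ≤ G := by
    rw [Finset.card_eq_sum_card_fiberwise (f := fun t => a (t + 1)) (t := Finset.univ)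
      (fun t _ => Finset.mem_coe.2 (Finset.mem_univ _))]
    exact Finset.sum_le_sum fun i _ => hAi i
  have hBcard : B.card ≤ (badPhases S β θ ε a x T).card :=
    card_badRounds_le h T fun t ht => by
      obtain ⟨h1, h2⟩ := Finset.mem_filter.1 ht
      obtain ⟨h3, h4⟩ := Finset.mem_filter.1 h1
      exact ⟨h3, h4, h2⟩
  -- forced exploration is at most half of the exploration count, up to a constant, so that the
  -- exploration count is bounded by the number of the other exploration rounds
  have hUcard : (U.card : ℝ) ≤ β (2 * K + 2 * G) + B.card + K := by
    have h1 : (U.card : ℝ) ≤ β (U.card + (B.card + A.card)) + K := by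
      have := card_underexplored_le hβ (fun n => (hβ_bound n).1) h T (U := U)
        fun t ht => Finset.mem_filter.1 ht
      rw [exploreCount_eq_card, ← hE] at this
      rwa [Finset.card_filter_add_card_filter_not, Finset.card_filter_add_card_filter_not]
    have h2 : U.card + (B.card + A.card) ≤ 2 * K + 2 * G + 2 * B.card := by
      have h3 := (hβ_bound (U.card + (B.card + A.card))).2
      have h4 : (A.card : ℝ) ≤ G := by exact_mod_cast hAcard
      have : ((U.card + (B.card + A.card) : ℕ) : ℝ) ≤ ((2 * K + 2 * G + 2 * B.card : ℕ) : ℝ) := by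
        push_cast at h3 ⊢
        linarith
      exact_mod_cast this
    have h5 := hβ h2
    have h6 := hβ_subadd (2 * K + 2 * G) (2 * B.card)
    have h7 := (hβ_bound (2 * B.card)).2
    push_cast at h7
    linarith
  have hterm : ∀ t ∈ Finset.range T, gap θ (a (t + 1)) ≤
      (if t < K then M else 0) + (if t ∈ W then M else 0) + (if t ∈ U then M else 0) +
      (if t ∈ B then M else 0) + if t ∈ A then gap θ (a (t + 1)) else 0 := by
    intro t ht
    have hg := gap_nonneg θ (a (t + 1))
    have hgM := hM (a (t + 1))
    have hdisj : t < K ∨ t ∈ W ∨ t ∈ U ∨ t ∈ B ∨ t ∈ A ∨ gap θ (a (t + 1)) = 0 := by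
      by_cases htK : t < K
      · exact Or.inl htK
      have htK' : K < t + 1 := by omega
      by_cases he : Exploits S σ α a x (t + 1)
      · by_cases hb : a (t + 1) = best θ
        · simp [hb, gap_best]
        · exact Or.inr (Or.inl (Finset.mem_filter.2
            ⟨ht, exists_deviation_of_exploits hα h htK' (by omega) he hb⟩))
      have htE : t ∈ E := mem_exploreRounds.2 ⟨Finset.mem_range.1 ht, htK', he⟩
      by_cases hu : Underexplored S σ α β a x (t + 1)
      · exact Or.inr (Or.inr (Or.inl (Finset.mem_filter.2 ⟨htE, hu⟩)))
      have htN : t ∈ N := Finset.mem_filter.2 ⟨htE, hu⟩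
      by_cases hbad : ∃ j, ε ≤ |estimate S a x (t + 1) j - θ j|
      · exact Or.inr (Or.inr (Or.inr (Or.inl (Finset.mem_filter.2 ⟨htN, hbad⟩))))
      · exact Or.inr (Or.inr (Or.inr (Or.inr (Or.inl (Finset.mem_filter.2 ⟨htN, hbad⟩)))))
    have hif : ∀ (p : Prop) [Decidable p], (0 : ℝ) ≤ if p then M else 0 :=
      fun p _ => by split_ifs <;> simp [hM0]
    have h0 := hif (t < K)
    have h1 := hif (t ∈ W)
    have h2 := hif (t ∈ U)
    have h3 := hif (t ∈ B)
    have h4 : (0 : ℝ) ≤ if t ∈ A then gap θ (a (t + 1)) else 0 := by split_ifs <;> simp [hg]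
    rcases hdisj with hc | hc | hc | hc | hc | hc <;> [rw [if_pos hc] at h0 ⊢;
      rw [if_pos hc] at h1 ⊢; rw [if_pos hc] at h2 ⊢; rw [if_pos hc] at h3 ⊢;
      rw [if_pos hc] at h4 ⊢; skip] <;> linarith
  have hcount : ∀ V : Finset ℕ, V ⊆ Finset.range T →
      ∑ t ∈ Finset.range T, (if t ∈ V then M else 0) = M * V.card := fun V hV => by
    rw [← Finset.sum_filter, Finset.filter_mem_eq_inter, Finset.inter_eq_right.2 hV,
      Finset.sum_const, nsmul_eq_mul, mul_comm]
  have hER : E ⊆ Finset.range T := Finset.filter_subset _ _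
  have hNR : N ⊆ Finset.range T := (Finset.filter_subset _ _).trans hER
  have hAR : A ⊆ Finset.range T := (Finset.filter_subset _ _).trans hNR
  have hinit : ∑ t ∈ Finset.range T, (if t < K then M else 0) ≤ M * K := by
    rw [← Finset.sum_filter, Finset.sum_const, nsmul_eq_mul, mul_comm]
    have : ((Finset.range T).filter (· < K)).card ≤ K := by
      refine (Finset.card_le_card (t := Finset.range K) fun t ht => ?_).trans_eq
        (Finset.card_range K)
      exact Finset.mem_range.2 (Finset.mem_filter.1 ht).2
    gcongr
  have hmain : ∑ t ∈ Finset.range T, (if t ∈ A then gap θ (a (t + 1)) else 0) ≤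
      ∑ i, (⌈C i * (4 * α * Real.log T)⌉₊ : ℝ) * gap θ i := by
    rw [← Finset.sum_filter, Finset.filter_mem_eq_inter, Finset.inter_eq_right.2 hAR,
      ← Finset.sum_fiberwise A fun t => a (t + 1)]
    refine Finset.sum_le_sum fun i _ => ?_
    rw [Finset.sum_congr rfl fun t ht => by rw [(Finset.mem_filter.1 ht).2], Finset.sum_const,
      nsmul_eq_mul]
    exact mul_le_mul_of_nonneg_right (by exact_mod_cast hAi i) (gap_nonneg θ i)
  rw [sum_playCount_mul_gap]
  refine (Finset.sum_le_sum hterm).trans ?_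
  simp only [Finset.sum_add_distrib]
  rw [hcount W (Finset.filter_subset _ _), hcount U ((Finset.filter_subset _ _).trans hER),
    hcount B ((Finset.filter_subset _ _).trans hNR)]
  have hB' : (B.card : ℝ) ≤ (badPhases S β θ ε a x T).card := by exact_mod_cast hBcard
  have h1 := mul_le_mul_of_nonneg_left hUcard hM0
  have h2 := mul_le_mul_of_nonneg_left hB' hM0
  linarith

end Path

/-! ### The expected regret -/

section Regret

variable {K : ℕ} {S : Fin K → Finset (Fin K)} {σ α : ℝ} {β : ℕ → ℝ} {θ : Fin K → ℝ}
  {Ω : Type*} {mΩ : MeasurableSpace Ω} {P : Measure Ω} {ℱ : Filtration ℕ mΩ}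
  {X : ℕ → Fin K → Fin K → Ω → ℝ} {I : ℕ → Ω → Fin K}

theorem playCount_integrable [IsFiniteMeasure P] (hI : ∀ t, Measurable[ℱ t] (I (t + 1)))
    (i : Fin K) (t : ℕ) :
    Integrable (fun ω => (playCount (fun s => I s ω) (t + 1) i : ℝ)) P := by
  induction t with
  | zero => simp [playCount]
  | succ t ih =>
    have h1 : Measurable (I (t + 1)) := (hI t).mono (ℱ.le t) le_rfl
    simp_rw [playCount_succ (Nat.le_add_left 1 t), Nat.cast_add]
    refine ih.add (Integrable.of_bound (C := 1) ?_ (ae_of_all _ fun ω => ?_))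
    · exact ((measurable_of_finite fun k : Fin K =>
        ((if k = i then 1 else 0 : ℕ) : ℝ)).comp h1).aestronglyMeasurable
    · split_ifs <;> simp

open Classical in
/-- The expected number of events that occur is the sum of their probabilities. -/
theorem integral_card_filter [IsFiniteMeasure P] {Q : ℕ → Set Ω} (hQ : ∀ t, MeasurableSet (Q t))
    (T : ℕ) : Integrable (fun ω => (((Finset.range T).filter fun t => ω ∈ Q t).card : ℝ)) P ∧
      ∫ ω, (((Finset.range T).filter fun t => ω ∈ Q t).card : ℝ) ∂P =
        ∑ t ∈ Finset.range T, P.real (Q t) := by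
  have heq : (fun ω => (((Finset.range T).filter fun t => ω ∈ Q t).card : ℝ)) =
      fun ω => ∑ t ∈ Finset.range T, (Q t).indicator (fun _ => (1 : ℝ)) ω := by
    ext ω
    rw [Finset.card_filter]
    push_cast
    exact Finset.sum_congr rfl fun t _ => by simp [Set.indicator_apply]
  have hi : ∀ t, Integrable ((Q t).indicator fun _ => (1 : ℝ)) P := fun t =>
    (integrable_const 1).indicator (hQ t)
  rw [heq]
  refine ⟨integrable_finsetSum _ fun t _ => hi t, ?_⟩
  rw [integral_finsetSum _ fun t _ => hi t]
  exact Finset.sum_congr rfl fun t _ => by rw [integral_indicator_const _ (hQ t)]; simp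

variable [IsProbabilityMeasure P]

/-- The expected number of rounds with an estimate outside its logarithmic confidence width is
bounded; this is where `α > 2` is used. -/
theorem exists_integral_wrongRounds_le (hσ : 0 < σ) (hα : 2 < α)
    (hX : GaussianObservations S σ θ P ℱ X) (hI : ∀ t, Measurable[ℱ t] (I (t + 1))) :
    ∃ B : ℝ, ∀ T, Integrable (fun ω => ((wrongRounds S σ α θ (fun s => I s ω)
        (fun s j => X s (I s ω) j ω) T).card : ℝ)) P ∧
      ∫ ω, ((wrongRounds S σ α θ (fun s => I s ω)
        (fun s j => X s (I s ω) j ω) T).card : ℝ) ∂P ≤ B := by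
  set Qj : ℕ → Fin K → Set Ω := fun t j => {ω | 0 < runObs S I j t ω ∧
    2 * σ ^ 2 * (α * Real.log (t + 1 : ℕ)) * runObs S I j t ω ≤ runDev S θ X I j t ω ^ 2}
  set Q : ℕ → Set Ω := fun t => ⋃ j, Qj t j
  have hQj : ∀ t j, MeasurableSet (Qj t j) := fun t j => by
    have hn := runObs_measurable (S := S) hI j t
    have hn' : Measurable fun ω => (runObs S I j t ω : ℝ) := measurable_from_nat.comp hn
    exact (measurableSet_lt measurable_const hn).inter (measurableSet_le
      (hn'.const_mul _) ((runDev_measurable hX hI j t).pow_const 2))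
  have hprob : ∀ t j, P.real (Qj t j) ≤ 2 * ((t + 1 : ℕ) : ℝ) ^ (1 - α) := by
    intro t j
    rcases Nat.eq_zero_or_pos t with rfl | ht
    · have : Qj 0 j = ∅ := by ext ω; simp [Qj, runObs, obsCount]
      rw [this, measureReal_empty]; positivity
    have ht1 : (1 : ℝ) < (t + 1 : ℕ) := by exact_mod_cast Nat.lt_add_of_pos_left ht
    have hpos : (0 : ℝ) < (t + 1 : ℕ) := one_pos.trans ht1
    refine (prob_normalized_deviation_le hσ hX hI j
      (mul_pos (by linarith) (Real.log_pos ht1)) t).trans ?_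
    have hexp : Real.exp (-(α * Real.log (t + 1 : ℕ))) = ((t + 1 : ℕ) : ℝ) ^ (-α) := by
      rw [Real.rpow_def_of_pos hpos]; congr 1; ring
    have hle : (t : ℝ) ≤ (t + 1 : ℕ) := by exact_mod_cast Nat.le_succ t
    rw [hexp, sub_eq_add_neg, Real.rpow_add hpos, Real.rpow_one]
    calc (t : ℝ) * (2 * ((t + 1 : ℕ) : ℝ) ^ (-α))
        ≤ ((t + 1 : ℕ) : ℝ) * (2 * ((t + 1 : ℕ) : ℝ) ^ (-α)) := by gcongr
      _ = _ := by ring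
  have hsum : Summable fun t : ℕ => K * (2 * ((t + 1 : ℕ) : ℝ) ^ (1 - α)) :=
    (((summable_nat_add_iff 1).2 (Real.summable_nat_rpow.2 (by linarith))).mul_left 2).mul_left _
  refine ⟨∑' t : ℕ, K * (2 * ((t + 1 : ℕ) : ℝ) ^ (1 - α)), fun T => ?_⟩
  have hcard := integral_card_filter (P := P) (Q := Q)
    (fun t => MeasurableSet.iUnion fun j => hQj t j) T
  have hmem : ∀ ω t, ω ∈ Q t ↔ ∃ j, 0 < obsCount S (fun s => I s ω) (t + 1) j ∧
      2 * σ ^ 2 * (α * Real.log (t + 1 : ℕ)) * obsCount S (fun s => I s ω) (t + 1) j ≤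
      devSum S θ (fun s => I s ω) (fun s j => X s (I s ω) j ω) (t + 1) j ^ 2 :=
    fun ω t => Set.mem_iUnion
  simp only [hmem] at hcard
  refine ⟨hcard.1, hcard.2.trans_le ?_⟩
  refine le_trans (Finset.sum_le_sum fun t _ => ?_)
    (hsum.sum_le_tsum (Finset.range T) fun t _ => by positivity)
  refine (measureReal_iUnion_fintype_le _).trans ((Finset.sum_le_sum fun j _ => hprob t j).trans ?_)
  simp

/-- The expected number of exploration phases with a bad estimate is bounded; this is where the
summability of the exponentials of `β` is used. -/
theorem exists_integral_badPhases_le [NeZero K] (hσ : 0 < σ)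
    (hβ_sum : ∀ ε : ℝ, 0 < ε → Summable fun s : ℕ => Real.exp (-(β s * ε ^ 2) / (2 * K * σ ^ 2)))
    (hX : GaussianObservations S σ θ P ℱ X) (hI : ∀ t, Measurable[ℱ t] (I (t + 1)))
    {ε : ℝ} (hε : 0 < ε) :
    ∃ B : ℝ, ∀ T, Integrable (fun ω => ((badPhases S β θ ε (fun s => I s ω)
        (fun s j => X s (I s ω) j ω) T).card : ℝ)) P ∧
      ∫ ω, ((badPhases S β θ ε (fun s => I s ω)
        (fun s j => X s (I s ω) j ω) T).card : ℝ) ∂P ≤ B := by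
  have hK : (0 : ℝ) < K := by exact_mod_cast Nat.pos_of_ne_zero (NeZero.ne K)
  have hsum : Summable fun s : ℕ => K * (2 * Real.exp (-(β s * ε ^ 2) / (2 * K * σ ^ 2))) :=
    ((hβ_sum ε hε).mul_left 2).mul_left _
  refine ⟨∑' s : ℕ, K * (2 * Real.exp (-(β s * ε ^ 2) / (2 * K * σ ^ 2))), fun T => ?_⟩
  set Qj : ℕ → Fin K → Set Ω := fun s j => {ω | ∃ t ≤ T, β s / K ≤ runObs S I j t ω ∧
    ε * runObs S I j t ω ≤ |runDev S θ X I j t ω|}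
  set Q : ℕ → Set Ω := fun s => ⋃ j, Qj s j
  have hQj : ∀ s j, MeasurableSet (Qj s j) := fun s j => by
    have : Qj s j = ⋃ t, ⋃ _ : t ≤ T, {ω | β s / K ≤ runObs S I j t ω ∧
        ε * runObs S I j t ω ≤ |runDev S θ X I j t ω|} := by
      ext ω
      simp only [Qj, Set.mem_ofPred_eq, Set.mem_iUnion, exists_prop]
    rw [this]
    refine MeasurableSet.iUnion fun t => MeasurableSet.iUnion fun _ => ?_
    have hn : Measurable fun ω => (runObs S I j t ω : ℝ) :=
      measurable_from_nat.comp (runObs_measurable (S := S) hI j t)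
    exact (measurableSet_le measurable_const hn).inter (measurableSet_le
      (hn.const_mul _) (runDev_measurable hX hI j t).abs)
  have hprob : ∀ s j, P.real (Qj s j) ≤ 2 * Real.exp (-(β s * ε ^ 2) / (2 * K * σ ^ 2)) := by
    intro s j
    refine (prob_deviation_le hσ hX hI j hε T).trans_eq ?_
    congr 2
    field_simp
  have hcard := integral_card_filter (P := P) (Q := Q)
    (fun s => MeasurableSet.iUnion fun j => hQj s j) T
  have hmem : ∀ ω s, ω ∈ Q s ↔ ∃ j, ∃ t ≤ T,
      β s / K ≤ obsCount S (fun s => I s ω) (t + 1) j ∧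
      ε * obsCount S (fun s => I s ω) (t + 1) j ≤
      |devSum S θ (fun s => I s ω) (fun s j => X s (I s ω) j ω) (t + 1) j| :=
    fun ω s => Set.mem_iUnion
  simp only [hmem] at hcard
  refine ⟨hcard.1, hcard.2.trans_le ?_⟩
  refine le_trans (Finset.sum_le_sum fun s _ => ?_)
    (hsum.sum_le_tsum (Finset.range T) fun s _ => by positivity)
  refine (measureReal_iUnion_fintype_le _).trans ((Finset.sum_le_sum fun j _ => hprob s j).trans ?_)
  simp

/-- The expected regret, when `C` bounds the solutions of the linear program for all parameters within
`ε` of `θ`. -/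
theorem exists_regret_le [NeZero K] (hσ : 0 < σ) (hα : 2 < α) (hβ : Monotone β)
    (hβ_bound : ∀ n, 0 ≤ β n ∧ β n ≤ n / 2) (hβ_subadd : ∀ m n, β (m + n) ≤ β m + β n)
    (hβ_sum : ∀ ε : ℝ, 0 < ε → Summable fun s : ℕ => Real.exp (-(β s * ε ^ 2) / (2 * K * σ ^ 2)))
    (hX : GaussianObservations S σ θ P ℱ X) (hI : IsAlgorithmRun S σ α β P ℱ X I)
    {C : Fin K → ℝ} (hC : ∀ i, 0 ≤ C i) {ε : ℝ} (hε0 : 0 < ε)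
    (hε : ∀ θ' : Fin K → ℝ, (∀ j, |θ' j - θ j| < ε) → (lpSolutions S σ θ').Nonempty ∧
      ∀ c ∈ lpSolutions S σ θ', ∀ i, c i ≤ C i) :
    ∃ M B : ℝ, ∀ T : ℕ, regret θ P I T ≤
      ∑ i, (⌈C i * (4 * α * Real.log T)⌉₊ : ℝ) * gap θ i +
      M * β (2 * K + 2 * ∑ i, ⌈C i * (4 * α * Real.log T)⌉₊) + B := by
  obtain ⟨i₀, hi₀⟩ := Finite.exists_max (gap θ)
  set M := gap θ i₀
  have hM : 0 ≤ M := gap_nonneg θ i₀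
  obtain ⟨B₁, hB₁⟩ := exists_integral_wrongRounds_le hσ hα hX hI.nonanticipating
  obtain ⟨B₂, hB₂⟩ := exists_integral_badPhases_le hσ hβ_sum hX hI.nonanticipating hε0
  refine ⟨M, M * (2 * K + B₁ + 2 * B₂), fun T => ?_⟩
  obtain ⟨hi₁, hb₁⟩ := hB₁ T
  obtain ⟨hi₂, hb₂⟩ := hB₂ T
  have hN := fun i => (playCount_integrable (P := P) hI.nonanticipating i T).mul_const (gap θ i)
  set m := ∑ i, (⌈C i * (4 * α * Real.log T)⌉₊ : ℝ) * gap θ i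
  set b := β (2 * K + 2 * ∑ i, ⌈C i * (4 * α * Real.log T)⌉₊)
  have hreg : regret θ P I T =
      ∫ ω, ∑ i, (playCount (fun t => I t ω) (T + 1) i : ℝ) * gap θ i ∂P := by
    rw [integral_finsetSum _ fun i _ => hN i, regret]
    exact Finset.sum_congr rfl fun i _ => (integral_mul_const _ _).symm
  rw [hreg]
  have hmono : ∀ {f g : Ω → ℝ}, Integrable f P → Integrable g P →
      (∀ᵐ ω ∂P, ∑ i, (playCount (fun t => I t ω) (T + 1) i : ℝ) * gap θ i ≤
        m + M * (2 * K + b + f ω + 2 * g ω)) →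
      ∫ ω, ∑ i, (playCount (fun t => I t ω) (T + 1) i : ℝ) * gap θ i ∂P ≤
        m + M * (2 * K + b + ∫ ω, f ω ∂P + 2 * ∫ ω, g ω ∂P) := by
    intro f g hf hg hle
    have h1 : Integrable (fun ω => 2 * K + b + f ω) P := (integrable_const _).add hf
    have h2 : Integrable (fun ω => 2 * K + b + f ω + 2 * g ω) P := h1.add (hg.const_mul 2)
    refine (integral_mono_ae (integrable_finsetSum _ fun i _ => hN i)
      ((integrable_const m).add (h2.const_mul M)) hle).trans_eq ?_
    simp only [Pi.add_apply]
    rw [integral_add (integrable_const _) (h2.const_mul M), integral_const_mul,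
      integral_add h1 (hg.const_mul 2), integral_add (integrable_const _) hf, integral_const_mul]
    simp
  refine (hmono hi₁ hi₂ ?_).trans ?_
  · filter_upwards [hI.follows] with ω hω
    exact path_regret_le (by linarith) hβ hβ_bound hβ_subadd hω hC hε hi₀ T
  · have := mul_le_mul_of_nonneg_left
      (add_le_add hb₁ (mul_le_mul_of_nonneg_left hb₂ zero_le_two)) hM
    linarith

end Regret

/-! ### Asymptotics -/

/-- Relative to `log T`, rounding up and the forced exploration term disappear in the limit. -/
theorem tendsto_regretBound_div_log {K : ℕ} {α : ℝ} (hα : 0 < α) {β : ℕ → ℝ}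
    (hβ_little : β =o[atTop] (fun n : ℕ => (n : ℝ))) {C : Fin K → ℝ} (hC : ∀ i, 0 ≤ C i)
    {i₀ : Fin K} (hC₀ : 0 < C i₀) (d : Fin K → ℝ) (M B : ℝ) :
    Tendsto (fun T : ℕ => (∑ i, (⌈C i * (4 * α * Real.log T)⌉₊ : ℝ) * d i +
      M * β (2 * K + 2 * ∑ i, ⌈C i * (4 * α * Real.log T)⌉₊) + B) / Real.log T) atTop
      (𝓝 (4 * α * ∑ i, C i * d i)) := by
  have hlog : Tendsto (fun T : ℕ => Real.log T) atTop atTop :=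
    Real.tendsto_log_atTop.comp tendsto_natCast_atTop_atTop
  have hceil : ∀ i, Tendsto (fun T : ℕ => (⌈C i * (4 * α * Real.log T)⌉₊ : ℝ) / Real.log T) atTop
      (𝓝 (C i * (4 * α))) := fun i => by
    have := (tendsto_nat_ceil_mul_div_atTop (R := ℝ) (a := C i * (4 * α))
      (mul_nonneg (hC i) (by positivity))).comp hlog
    refine this.congr fun T => ?_
    simp [mul_assoc]
  set n : ℕ → ℕ := fun T => 2 * K + 2 * ∑ i, ⌈C i * (4 * α * Real.log T)⌉₊ with hn
  have hn_lim : Tendsto (fun T => (n T : ℝ) / Real.log T) atTop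
      (𝓝 (0 + 2 * ∑ i, C i * (4 * α))) := by
    have h1 : Tendsto (fun T : ℕ => (2 * K : ℝ) / Real.log T) atTop (𝓝 0) :=
      tendsto_const_nhds.div_atTop hlog
    refine (h1.add ((tendsto_finsetSum Finset.univ fun i _ => hceil i).const_mul 2)).congr
      fun T => ?_
    rw [← Finset.sum_div, hn]
    push_cast
    ring
  have hn_top : Tendsto n atTop atTop := by
    have h1 : Tendsto (fun T : ℕ => C i₀ * (4 * α) * Real.log T) atTop atTop :=
      hlog.const_mul_atTop (by positivity)
    refine tendsto_natCast_atTop_iff.1 (tendsto_atTop_mono (fun T => ?_) h1)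
    have h2 : ⌈C i₀ * (4 * α * Real.log T)⌉₊ ≤ n T :=
      (Finset.single_le_sum (f := fun i => ⌈C i * (4 * α * Real.log T)⌉₊)
        (fun _ _ => Nat.zero_le _) (Finset.mem_univ i₀)).trans (by simp only [hn]; omega)
    calc C i₀ * (4 * α) * Real.log T = C i₀ * (4 * α * Real.log T) := by ring
      _ ≤ ⌈C i₀ * (4 * α * Real.log T)⌉₊ := Nat.le_ceil _
      _ ≤ n T := by exact_mod_cast h2
  have hn_O : (fun T => (n T : ℝ)) =O[atTop] fun T : ℕ => Real.log T :=
    Asymptotics.isBigO_of_div_tendsto_nhds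
      ((hlog.eventually_gt_atTop 0).mono fun T hT h0 => absurd h0 hT.ne') _ hn_lim
  have hβn : Tendsto (fun T => β (n T) / Real.log T) atTop (𝓝 0) :=
    ((hβ_little.comp_tendsto hn_top).trans_isBigO hn_O).tendsto_div_nhds_zero
  have hB : Tendsto (fun T : ℕ => B / Real.log T) atTop (𝓝 0) := tendsto_const_nhds.div_atTop hlog
  have := ((tendsto_finsetSum Finset.univ fun i _ => (hceil i).mul_const (d i)).add
    (hβn.const_mul M)).add hB
  have hval : ∑ i, C i * (4 * α) * d i + M * 0 + 0 = 4 * α * ∑ i, C i * d i := by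
    rw [Finset.mul_sum, mul_zero, add_zero, add_zero]
    exact Finset.sum_congr rfl fun i _ => by ring
  rw [hval] at this
  refine this.congr fun T => ?_
  rw [add_div, add_div, Finset.sum_div, mul_div_assoc]
  congr 2
  exact Finset.sum_congr rfl fun i _ => by ring

end SideObs

end

theorem mainTheorem5 {K : ℕ} [NeZero K] (hK : 2 ≤ K)
    -- observation structure: uniform variance, every action observable
    (S : Fin K → Finset (Fin K)) (hS : ∀ j, ∃ i, j ∈ S i)
    (σ : ℝ) (hσ : 0 < σ)
    -- parameters of the algorithm
    (α : ℝ) (hα : 2 < α)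
    (β : ℕ → ℝ) (hβ_mono : Monotone β)
    (hβ_bound : ∀ n, 0 ≤ β n ∧ β n ≤ n / 2)
    (hβ_subadd : ∀ m n, β (m + n) ≤ β m + β n)
    (hβ_little : β =o[atTop] (fun n : ℕ => (n : ℝ)))
    (hβ_sum : ∀ ε : ℝ, 0 < ε → Summable fun s : ℕ => Real.exp (-(β s * ε ^ 2) / (2 * K * σ ^ 2)))
    -- the environment
    (D : ℝ) (hD : 0 < D) (θ : Fin K → ℝ) (hθ : ∀ i, θ i ∈ Set.Icc 0 D)
    (hbest : ∃ i₁, ∀ i, i ≠ i₁ → θ i < θ i₁)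
    (huniq : SideObs.UniqueLPSolution S σ θ)
    {Ω : Type*} [mΩ : MeasurableSpace Ω] (P : Measure Ω) [IsProbabilityMeasure P]
    (ℱ : Filtration ℕ mΩ) (X : ℕ → Fin K → Fin K → Ω → ℝ)
    (hX : SideObs.GaussianObservations S σ θ P ℱ X)
    (I : ℕ → Ω → Fin K) (hI : SideObs.IsAlgorithmRun S σ α β P ℱ X I) :
    limsup (fun T : ℕ => ((SideObs.regret θ P I T / Real.log T : ℝ) : EReal)) atTop ≤
      ((4 * α * sInf (SideObs.cost θ '' SideObs.feasible S σ θ) : ℝ) : EReal) := by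
  open SideObs in
  obtain ⟨i₁, hi₁⟩ := hbest
  have hb : best θ = i₁ := best_eq_of_forall_lt hi₁
  have huniq_best : ∀ i, i ≠ best θ → θ i < θ (best θ) := hb ▸ hi₁
  have hα0 : 0 < α := by linarith
  obtain ⟨c, hc, -⟩ := lpSolutions_nonempty (σ := σ) hS (secondGap_pos hK huniq_best)
  have hinf : cost θ c ≤ sInf (cost θ '' feasible S σ θ) :=
    le_csInf ⟨_, c, hc.1, rfl⟩ (by rintro _ ⟨c', hc', rfl⟩; exact hc.2 c' hc')
  have key : ∀ δ : ℝ, 0 < δ →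
      limsup (fun T : ℕ => ((regret θ P I T / Real.log T : ℝ) : EReal)) atTop ≤
        ((4 * α * (cost θ c + δ * ∑ i, gap θ i) : ℝ) : EReal) := by
    intro δ hδ
    obtain ⟨R, hR, hev⟩ := eventually_lpSolutions hK hS huniq_best huniq hc hδ
    obtain ⟨ε, hε, hball⟩ := Metric.eventually_nhds_iff.1 hev
    -- the coordinate at the best action does not enter the cost, so a crude bound suffices there
    set C : Fin K → ℝ := fun i => if i = best θ then R else c i + δ with hCdef
    have hC : ∀ i, 0 ≤ C i := fun i => by
      have := hc.1.2.1 i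
      simp only [hCdef]
      split_ifs <;> linarith
    obtain ⟨M, B, hreg⟩ := exists_regret_le hσ hα hβ_mono hβ_bound hβ_subadd hβ_sum hX hI hC hε
      fun θ' hθ' => by
        obtain ⟨-, h2, h3⟩ := hball ((dist_pi_lt_iff hε).2 fun j => by
          rw [Real.dist_eq]; exact hθ' j)
        refine ⟨h2, fun c' hc' i => ?_⟩
        simp only [hCdef]
        split_ifs with h
        · exact (h3 c' hc').1 i
        · exact (h3 c' hc').2 i h
    have hlim := (continuous_coe_real_ereal.tendsto _).comp (tendsto_regretBound_div_log hα0
      hβ_little hC (i₀ := best θ) (by simpa [hCdef] using hR) (gap θ) M B)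
    have hcost : ∑ i, C i * gap θ i ≤ cost θ c + δ * ∑ i, gap θ i := by
      rw [cost, Finset.mul_sum, ← Finset.sum_add_distrib]
      refine Finset.sum_le_sum fun i _ => ?_
      by_cases h : i = best θ
      · simp [h, gap_best]
      · simp [hCdef, h, add_mul]
    calc _ ≤ _ := limsup_le_limsup (Eventually.of_forall fun T => EReal.coe_le_coe_iff.2
            (div_le_div_of_nonneg_right (hreg T) (Real.log_natCast_nonneg T)))
      _ = _ := hlim.limsup_eq
      _ ≤ _ := EReal.coe_le_coe_iff.2 (by gcongr)
  have hδ : Tendsto (fun δ : ℝ => ((4 * α * (cost θ c + δ * ∑ i, gap θ i) : ℝ) : EReal)) (𝓝[>] 0)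
      (𝓝 ((4 * α * cost θ c : ℝ) : EReal)) := by
    have h : Continuous fun δ : ℝ => 4 * α * (cost θ c + δ * ∑ i, gap θ i) := by fun_prop
    have h' := (continuous_coe_real_ereal.comp h).tendsto 0
    simp only [Function.comp_def, zero_mul, add_zero] at h'
    exact h'.mono_left nhdsWithin_le_nhds
  refine (ge_of_tendsto hδ (eventually_mem_nhdsWithin.mono key)).trans ?_
  exact EReal.coe_le_coe_iff.2 (by gcongr)
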